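/- Let $\alpha\in(0,2)$, $\lambda_+,\lambda_->0$, $\mu,\beta\in\mathbb R$ and $a,b>0$. For tempering parameters $\ell_+,\ell_->0$, let $\mathrm{stdCTS}(\alpha,\ell_+,\ell_-)$ be the standardized classical tempered stable law, i.e. the law with characteristic function $$t\mapsto\exp\int_{\mathbb R}(e^{itx}-1-itx)\,C\Big(\frac{e^{-\ell_+x}}{x^{1+\alpha}}\mathbf 1_{x>0}+\frac{e^{-\ell_-|x|}}{|x|^{1+\alpha}}\mathbf 1_{x<0}\Big)dx,\qquad C=\frac{1}{\Gamma(2-\alpha)(\ell_+^{\alpha-2}+\ell_-^{\alpha-2})}.$$ Let $Y\sim MixedTS(\mu,\beta,\alpha,\lambda_+,\lambda_-)-\Gamma(a,b)$, i.e. $Y$ has the law of $\mu+\beta V+\sqrt V X$, where $V$ has the Gamma law with shape $a$ and rate $b$ and, conditionally on $V$, $X\sim \mathrm{stdCTS}(\alpha,\lambda_+\sqrt V,\lambda_-\sqrt V)$. For $u\in[-\lambda_-,\lambda_+]$ put $$\Phi_H(u)=\frac{(\lambda_+-u)^\alpha-\lambda_+^\alpha+(\lambda_-+u)^\alpha-\lambda_-^\alpha}{\alpha(\alpha-1)(\lambda_+^{\alpha-2}+\lambda_-^{\alpha-2})}+\frac{(\lambda_+^{\alpha-1}-\lambda_-^{\alpha-1})u}{(\alpha-1)(\lambda_+^{\alpha-2}+\lambda_-^{\alpha-2})}\quad(\alpha\ne1),$$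 and, for $\alpha=1$, let $\Phi_H$ be the limit of this expression, $$\Phi_H(u)=\frac{(\lambda_+-u)\log\frac{\lambda_+-u}{\lambda_+}+(\lambda_-+u)\log\frac{\lambda_-+u}{\lambda_-}}{\lambda_+^{-1}+\lambda_-^{-1}}\qquad(0\log0=0).$$ Let $G(u)=\beta u+\Phi_H(u)$, and let $r^\star=\sup\{u\in\mathbb R: E[e^{uY}]<\infty\}$ and $-q^\star=\inf\{u\in\mathbb R:E[e^{uY}]<\infty\}$. Then $r^\star,q^\star\in(0,\infty)$ and: 1. If $G(\lambda_+)\le b$, then $r^\star=\lambda_+$. If $G(\lambda_+)>b$, then $r^\star=u_+$, where $u_+\in(0,\lambda_+)$ is a solution of $G(u)=b$. 2. If $G(-\lambda_-)\le b$, then $q^\star=\lambda_-$. If $G(-\lambda_-)>b$, then $q^\star=-u_-$, where $u_-\in(-\lambda_-,0)$ is a solution of $G(u)=b$. 3. The equation $G(u)=b$ has no solutions in $[-\lambda_-,\lambda_+]$ other than, possibly, $r^\star$ and $-q^\star$; in particular $u_+$ and $u_-$ are unique. 4. The tails of $Y$ are log-exponential: as $x\to+\infty$, $$\log P(Y>x)\sim-r^\star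 x,\qquad \log P(Y\le-x)\sim-q^\star x.$$ -/

import Mathlib

open MeasureTheory ProbabilityTheory Filter Asymptotics

noncomputable section

/-- Lévy density of the classical tempered stable law `CTS(α, lp, lm, Cp, Cm, m)`:
`Cp * exp (-lp * x) / x ^ (1 + α)` for `x > 0` and
`Cm * exp (-lm * |x|) / |x| ^ (1 + α)` for `x < 0`. -/
def ctsLevyDensity (α lp lm Cp Cm x : ℝ) : ℝ :=
  if 0 < x then Cp * Real.exp (-lp * x) / x ^ (1 + α)
  else if x < 0 then Cm * Real.exp (-lm * |x|) / |x| ^ (1 + α)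
  else 0

/-- Characteristic exponent of `CTS(α, lp, lm, Cp, Cm, m)`, in Lévy–Khintchine form with full
compensation of the jumps, so that `m` is the mean. -/
def ctsCharExponent (α lp lm Cp Cm m t : ℝ) : ℂ :=
  Complex.I * t * m +
    ∫ x : ℝ, (Complex.exp (Complex.I * t * x) - 1 - Complex.I * t * x) *
      (ctsLevyDensity α lp lm Cp Cm x : ℂ)

/-- `ρ` is the classical tempered stable law `CTS(α, lp, lm, Cp, Cm, m)`. -/
structure IsCTS (α lp lm Cp Cm m : ℝ) (ρ : Measure ℝ) : Prop where
  isProbabilityMeasure : IsProbabilityMeasure ρ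
  charFun_eq : ∀ t : ℝ, charFun ρ t = Complex.exp (ctsCharExponent α lp lm Cp Cm m t)

/-- The constant that normalizes the variance of a tempered stable law to one. -/
def stdCTSConst (α lp lm : ℝ) : ℝ :=
  1 / (Real.Gamma (2 - α) * (lp ^ (α - 2) + lm ^ (α - 2)))

/-- `ρ` is the standardized (mean zero, variance one) tempered stable law
`stdCTS(α, lp, lm)`. -/
def IsStdCTS (α lp lm : ℝ) (ρ : Measure ℝ) : Prop :=
  IsCTS α lp lm (stdCTSConst α lp lm) (stdCTSConst α lp lm) 0 ρ

/-- `ρ` is the law `MixedTS(μ, β, α, lp, lm) - F`, that is, the law of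
`μ + β V + √V X`, where `V` is positive with law `F` and, conditionally on `V = v`, the variable
`X` has law `stdCTS(α, lp √v, lm √v)`. The kernel `κ` is the conditional law of `X` given `V`, so
that `F ⊗ₘ κ` is the joint law of `(V, X)`. -/
def IsMixedTS (μ β α lp lm : ℝ) (F ρ : Measure ℝ) : Prop :=
  (∀ᵐ v ∂F, 0 < v) ∧
  ∃ κ : Kernel ℝ ℝ, IsMarkovKernel κ ∧
    (∀ᵐ v ∂F, IsStdCTS α (lp * √v) (lm * √v) (κ v)) ∧
    ρ = (F ⊗ₘ κ).map (fun p : ℝ × ℝ => μ + β * p.1 + √p.1 * p.2)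

/-- The cumulant generating function `Φ_H` of `H ∼ stdCTS(α, lp, lm)` on `[-lm, lp]`. For `α = 1`
it is the limit of the expression for `α ≠ 1`. -/
def PhiH (α lp lm u : ℝ) : ℝ :=
  if α = 1 then
    ((lp - u) * Real.log ((lp - u) / lp) + (lm + u) * Real.log ((lm + u) / lm)) /
      (lp⁻¹ + lm⁻¹)
  else
    ((lp - u) ^ α - lp ^ α + (lm + u) ^ α - lm ^ α) /
        (α * (α - 1) * (lp ^ (α - 2) + lm ^ (α - 2))) +
      (lp ^ (α - 1) - lm ^ (α - 1)) * u / ((α - 1) * (lp ^ (α - 2) + lm ^ (α - 2)))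

end

/-! Given V = v, the variable √v X is infinitely divisible with Lévy measure v·N, where N is the
Lévy measure of stdCTS(α, lp, lm): the factor √v undoes the scaling of the tempering. Hence E[e^{uY}
| V = v] = exp(uμ + v G(u)) for u in (-lm, lp), with G(u) = βu + Φ_H(u), and the gamma average of
this is finite as soon as G(u) < b. Since G is convex and G(0) = 0 < b, it meets the level b at most
once on (0, lp], and `exists_critical` produces the candidate r, either lp or the root. Chernoff's
bound then gives P(Y ≥ x) ≤ M e^{-ux} for every u in (0, r).

A matching lower bound e^{-(r+ε)x} has two possible sources. If G(lp) ≤ b, keep V in [1, 2] and let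
a single jump of size about x do the work; its rate is lp (`IsTSMixture.eventually_le_of_jump`). If
G(lp) > b, let V be of size v ≈ x/G'(r). Cramér's bound for the conditional law contributes exp(-v(r
Φ_H'(r) - Φ_H(r))), the gamma density contributes e^{-bv}, and G(r) = b turns the total exponent
into -r G'(r) v ≈ -r x (`IsTSMixture.eventually_le_of_root`). The lower bound also excludes finite
exponential moments beyond r. Reflecting Y exchanges the temperings and gives the left tail.

The conditional laws are known only through their characteristic functions. Their moments and tails
are transferred from compensated compound Poisson laws, in which small jumps are discarded, by
Lévy's continuity theorem and the portmanteau theorem (`lintegral_exp_le`, `integral_exp_eq`,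
`le_measure_Ici_of_charFun`). -/

/-! ### Compound Poisson laws: exponential moments and characteristic functions. -/

noncomputable section CompoundPoisson

open scoped ENNReal Nat Topology

/-- Iterated convolution powers of a measure on the real line. -/
def convPow (ν : Measure ℝ) : ℕ → Measure ℝ
  | 0 => Measure.dirac 0
  | k + 1 => convPow ν k ∗ ν

/-- The compound Poisson law with finite jump measure `ν`. -/
def cpois (ν : Measure ℝ) : Measure ℝ :=
  Measure.sum fun k : ℕ => ENNReal.ofReal (Real.exp (-ν.real Set.univ) / k !) • convPow ν k

variable (ν : Measure ℝ) [IsFiniteMeasure ν]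

instance isFiniteMeasure_convPow (k : ℕ) : IsFiniteMeasure (convPow ν k) := by
  induction k with
  | zero => unfold convPow; infer_instance
  | succ k ih => unfold convPow; infer_instance

lemma convPow_one : convPow ν 1 = ν := by
  simp [convPow]

lemma lintegral_exp_conv (ρ τ : Measure ℝ) [SFinite τ] (u : ℝ) :
    ∫⁻ y, ENNReal.ofReal (Real.exp (u * y)) ∂(ρ ∗ τ) =
      (∫⁻ y, ENNReal.ofReal (Real.exp (u * y)) ∂ρ) *
        ∫⁻ y, ENNReal.ofReal (Real.exp (u * y)) ∂τ := by
  rw [Measure.lintegral_conv (by fun_prop), ← lintegral_mul_const _ (by fun_prop)]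
  refine lintegral_congr fun x => ?_
  rw [← lintegral_const_mul _ (by fun_prop)]
  refine lintegral_congr fun y => ?_
  rw [← ENNReal.ofReal_mul (Real.exp_pos _).le, ← Real.exp_add, mul_add]

lemma lintegral_exp_convPow (u : ℝ) (k : ℕ) :
    ∫⁻ y, ENNReal.ofReal (Real.exp (u * y)) ∂(convPow ν k) =
      (∫⁻ y, ENNReal.ofReal (Real.exp (u * y)) ∂ν) ^ k := by
  induction k with
  | zero => simp [convPow]
  | succ k ih => rw [convPow, lintegral_exp_conv, ih, pow_succ]

/-- Summing over the number of jumps produces the exponential series. The total mass of `cpois ν` is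
not needed here; it follows from the case u = 0. -/
lemma lintegral_exp_cpois {u : ℝ} (hu : Integrable (fun y => Real.exp (u * y)) ν) :
    ∫⁻ y, ENNReal.ofReal (Real.exp (u * y)) ∂(cpois ν) =
      ENNReal.ofReal (Real.exp (∫ y, (Real.exp (u * y) - 1) ∂ν)) := by
  have h0 : ∀ᵐ y ∂ν, 0 ≤ Real.exp (u * y) := ae_of_all _ fun y => (Real.exp_pos _).le
  have hI : 0 ≤ ∫ y, Real.exp (u * y) ∂ν := integral_nonneg_of_ae h0
  have hs := (NormedSpace.expSeries_div_hasSum_exp (∫ y, Real.exp (u * y) ∂ν)).mul_left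
    (Real.exp (-ν.real Set.univ))
  rw [← Real.exp_eq_exp_ℝ, ← Real.exp_add] at hs
  rw [cpois, lintegral_sum_measure, integral_sub hu (integrable_const _), integral_const, smul_eq_mul,
    mul_one, sub_eq_neg_add, ← hs.tsum_eq, ENNReal.ofReal_tsum_of_nonneg _ hs.summable]
  · refine tsum_congr fun k => ?_
    rw [lintegral_smul_measure, lintegral_exp_convPow, ← ofReal_integral_eq_lintegral_ofReal hu h0,
      smul_eq_mul, ← ENNReal.ofReal_pow hI, ← ENNReal.ofReal_mul (by positivity)]
    congr 1
    ring
  · intro k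
    positivity

instance isProbabilityMeasure_cpois : IsProbabilityMeasure (cpois ν) := by
  refine ⟨?_⟩
  have h := lintegral_exp_cpois ν (u := 0) (by simp)
  simpa using h

lemma charFun_convPow (t : ℝ) (k : ℕ) : charFun (convPow ν k) t = charFun ν t ^ k := by
  induction k with
  | zero => simp [convPow]
  | succ k ih => rw [convPow, charFun_conv, ih, pow_succ]

lemma charFun_cpois (t : ℝ) :
    charFun (cpois ν) t = Complex.exp (charFun ν t - ν.real Set.univ) := by
  have hi : Integrable (fun y : ℝ => Complex.exp (t * y * Complex.I)) (cpois ν) := by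
    refine (integrable_const (1 : ℝ)).mono' (by fun_prop) (ae_of_all _ fun y => ?_)
    have := Complex.norm_exp_ofReal_mul_I (t * y)
    push_cast at this
    exact this.le
  have h1 := hasSum_integral_measure (f := fun y : ℝ => Complex.exp (t * y * Complex.I))
    (μ := fun k : ℕ => ENNReal.ofReal (Real.exp (-ν.real Set.univ) / k !) • convPow ν k) hi
  have hs := (NormedSpace.expSeries_div_hasSum_exp (charFun ν t)).mul_left
    (Complex.exp (-ν.real Set.univ))
  rw [← Complex.exp_eq_exp_ℂ, ← Complex.exp_add] at hs
  rw [charFun_apply_real, sub_eq_neg_add]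
  refine h1.unique (hs.congr_fun ?_)
  intro k
  rw [integral_smul_measure, ← charFun_apply_real, charFun_convPow,
    ENNReal.toReal_ofReal (by positivity), Complex.real_smul]
  push_cast
  ring

/-- Only the term with exactly one jump is kept; this is the seed of the one-big-jump bound. -/
lemma le_cpois_apply (A : Set ℝ) :
    ENNReal.ofReal (Real.exp (-ν.real Set.univ)) * ν A ≤ cpois ν A := by
  refine le_trans ?_ (Measure.le_sum_apply _ A)
  refine le_trans ?_ (ENNReal.le_tsum 1)
  simp [convPow_one]

end CompoundPoisson

/-! ### Infinitely divisible laws as limits of compensated compound Poisson laws. -/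

noncomputable section LevyMeasure

open scoped ENNReal Nat Topology

lemma exp_sub_one_sub_id_nonneg (w : ℝ) : 0 ≤ Real.exp w - 1 - w := by
  linarith [Real.add_one_le_exp w]

lemma abs_exp_sub_one_le (w : ℝ) : |Real.exp w - 1| ≤ |w| * (1 + Real.exp w) := by
  have h1 := Real.add_one_le_exp w
  have h2 : Real.exp w - 1 ≤ w * Real.exp w := by
    have h3 := Real.add_one_le_exp (-w)
    have h4 : Real.exp w * Real.exp (-w) = 1 := by rw [← Real.exp_add]; simp
    nlinarith [Real.exp_pos w]
  have h5 := Real.exp_pos w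
  rcases le_total 0 w with hw | hw
  · rw [abs_of_nonneg hw, abs_of_nonneg (by linarith)]
    nlinarith
  · rw [abs_of_nonpos hw, abs_of_nonpos (by linarith [Real.exp_le_one_iff.2 hw])]
    nlinarith

lemma exp_sub_one_sub_id_le (w : ℝ) : Real.exp w - 1 - w ≤ w ^ 2 * (1 + Real.exp w) := by
  have h2 : Real.exp w - 1 ≤ w * Real.exp w := by
    have h3 := Real.add_one_le_exp (-w)
    have h4 : Real.exp w * Real.exp (-w) = 1 := by rw [← Real.exp_add]; simp
    nlinarith [Real.exp_pos w]
  have h5 : w * (Real.exp w - 1) ≤ |w| * (|w| * (1 + Real.exp w)) :=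
    (le_abs_self _).trans (by
      rw [abs_mul]
      exact mul_le_mul_of_nonneg_left (abs_exp_sub_one_le w) (abs_nonneg w))
  have h6 : |w| * (|w| * (1 + Real.exp w)) = w ^ 2 * (1 + Real.exp w) := by
    rw [← mul_assoc, abs_mul_abs_self]; ring
  linarith

lemma norm_cexp_I_mul_sub_one_sub_le (w : ℝ) :
    ‖Complex.exp (Complex.I * w) - 1 - Complex.I * w‖ ≤ 3 * w ^ 2 := by
  have hn : ‖Complex.I * (w : ℂ)‖ = |w| := by simp
  rcases le_total |w| 1 with hw | hw
  · have h := Complex.norm_exp_sub_one_sub_id_le (x := Complex.I * w) (by rw [hn]; exact hw)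
    rw [hn, sq_abs] at h
    nlinarith [sq_nonneg w]
  · have h1 : ‖Complex.exp (Complex.I * w) - 1‖ ≤ |w| :=
      Real.norm_exp_I_mul_ofReal_sub_one_le
    have h2 := norm_sub_le (Complex.exp (Complex.I * w) - 1) (Complex.I * (w : ℂ))
    rw [hn] at h2
    nlinarith [sq_abs w]

/-- The exponential moment of order `u`, away from zero, of a Lévy measure: `∫ y² e^{uy} N(dy)` is
finite. -/
def HasLevyExpMoment (N : Measure ℝ) (u : ℝ) : Prop :=
  Integrable (fun y => y ^ 2 * Real.exp (u * y)) N

/-- The Laplace exponent `∫ (e^{uy} - 1 - uy) N(dy)` of a centred Lévy measure. -/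
def levyExponent (N : Measure ℝ) (u : ℝ) : ℝ := ∫ y, (Real.exp (u * y) - 1 - u * y) ∂N

/-- The characteristic exponent of a centred Lévy measure. -/
def levyCharExponent (N : Measure ℝ) (t : ℝ) : ℂ :=
  ∫ y : ℝ, (Complex.exp (Complex.I * t * y) - 1 - Complex.I * t * y) ∂N

/-- The jumps of size larger than `1 / (n + 1)`. -/
def largeJumps (n : ℕ) : Set ℝ := {y | 1 / ((n : ℝ) + 1) < |y|}

lemma measurableSet_largeJumps (n : ℕ) : MeasurableSet (largeJumps n) :=
  measurableSet_lt measurable_const (by fun_prop)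

lemma monotone_largeJumps : Monotone largeJumps := by
  intro m n hmn y hy
  have hy : 1 / ((m : ℝ) + 1) < |y| := hy
  exact lt_of_le_of_lt (Nat.one_div_le_one_div hmn) hy

lemma iUnion_largeJumps : ⋃ n, largeJumps n = {y | y ≠ 0} := by
  ext y
  simp only [Set.mem_iUnion, largeJumps, Set.mem_ofPred_eq]
  constructor
  · rintro ⟨n, hn⟩ rfl
    rw [abs_zero] at hn
    exact absurd hn (not_lt.2 (by positivity))
  · intro hy
    exact exists_nat_one_div_lt (abs_pos.2 hy)

lemma Ioi_one_subset_largeJumps (n : ℕ) : Set.Ioi 1 ⊆ largeJumps n := by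
  intro y hy
  have hy : (1 : ℝ) < y := hy
  have h1 : 1 / ((n : ℝ) + 1) ≤ 1 := by
    rw [div_le_one (by positivity)]
    linarith [Nat.cast_nonneg (α := ℝ) n]
  exact (h1.trans_lt hy).trans_le (le_abs_self y)

variable {N : Measure ℝ}

/-- The sets exhaust everything except the origin, and f 0 = 0 makes a possible atom there harmless.
-/
lemma tendsto_setIntegral_largeJumps {E : Type*} [NormedAddCommGroup E] [NormedSpace ℝ E]
    {f : ℝ → E} (hf : Integrable f N) (h0 : f 0 = 0) :
    Tendsto (fun n => ∫ y in largeJumps n, f y ∂N) atTop (𝓝 (∫ y, f y ∂N)) := by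
  have h := tendsto_setIntegral_of_monotone (μ := N) (f := f) measurableSet_largeJumps
    monotone_largeJumps hf.integrableOn
  rwa [iUnion_largeJumps, setIntegral_eq_integral_of_forall_compl_eq_zero] at h
  intro y hy
  have : y = 0 := by simpa using hy
  rw [this, h0]

lemma integrable_exp_sub_one_sub {u : ℝ} (h0 : HasLevyExpMoment N 0) (hu : HasLevyExpMoment N u) :
    Integrable (fun y => Real.exp (u * y) - 1 - u * y) N := by
  refine ((h0.add hu).const_mul (u ^ 2)).mono' (by fun_prop) (ae_of_all _ fun y => ?_)
  rw [Real.norm_of_nonneg (exp_sub_one_sub_id_nonneg _)]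
  refine (exp_sub_one_sub_id_le _).trans (le_of_eq ?_)
  simp
  ring

lemma integrable_cexp_sub_one_sub (h0 : HasLevyExpMoment N 0) (t : ℝ) :
    Integrable (fun y : ℝ => Complex.exp (Complex.I * t * y) - 1 - Complex.I * t * y) N := by
  refine (h0.const_mul (3 * t ^ 2)).mono' (by fun_prop) (ae_of_all _ fun y => ?_)
  have h := norm_cexp_I_mul_sub_one_sub_le (t * y)
  push_cast at h
  rw [← mul_assoc] at h
  refine h.trans (le_of_eq ?_)
  simp
  ring

lemma integrableOn_largeJumps_exp {u : ℝ} (hu : HasLevyExpMoment N u) (n : ℕ) :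
    IntegrableOn (fun y => Real.exp (u * y)) (largeJumps n) N := by
  refine ((hu.const_mul (((n : ℝ) + 1) ^ 2)).integrableOn).mono' (by fun_prop)
    ((ae_restrict_mem (measurableSet_largeJumps n)).mono fun y hy => ?_)
  have hy : 1 / ((n : ℝ) + 1) < |y| := hy
  rw [div_lt_iff₀ (by positivity)] at hy
  rw [Real.norm_of_nonneg (Real.exp_pos _).le, ← mul_assoc]
  refine le_mul_of_one_le_left (Real.exp_pos _).le ?_
  rw [← sq_abs y]
  nlinarith

lemma isFiniteMeasure_restrict_largeJumps (h0 : HasLevyExpMoment N 0) (n : ℕ) :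
    IsFiniteMeasure (N.restrict (largeJumps n)) := by
  have h := integrableOn_largeJumps_exp h0 n
  simp only [zero_mul, Real.exp_zero, IntegrableOn] at h
  exact (integrable_const_iff_isFiniteMeasure one_ne_zero).1 h

lemma integrableOn_largeJumps_id (h0 : HasLevyExpMoment N 0) (n : ℕ) :
    IntegrableOn (fun y => y) (largeJumps n) N := by
  have h0' : Integrable (fun y : ℝ => ((n : ℝ) + 1) * (y ^ 2 * Real.exp (0 * y))) N :=
    h0.const_mul _
  refine h0'.integrableOn.mono' (by fun_prop)
    ((ae_restrict_mem (measurableSet_largeJumps n)).mono fun y hy => ?_)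
  have hy : 1 / ((n : ℝ) + 1) < |y| := hy
  rw [div_lt_iff₀ (by positivity)] at hy
  rw [Real.norm_eq_abs, zero_mul, Real.exp_zero, mul_one, ← sq_abs y]
  nlinarith [abs_nonneg y]

lemma lintegral_exp_map_add_const (ρ : Measure ℝ) (u c : ℝ) :
    ∫⁻ y, ENNReal.ofReal (Real.exp (u * y)) ∂(ρ.map (· + c)) =
      ENNReal.ofReal (Real.exp (u * c)) * ∫⁻ y, ENNReal.ofReal (Real.exp (u * y)) ∂ρ := by
  rw [lintegral_map (by fun_prop) (by fun_prop), ← lintegral_const_mul _ (by fun_prop)]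
  refine lintegral_congr fun y => ?_
  rw [← ENNReal.ofReal_mul (Real.exp_pos _).le, ← Real.exp_add]
  congr 2
  ring

/-- The compensated compound Poisson approximation obtained by discarding the jumps of size at most
`1 / (n + 1)`. -/
def levyApprox (N : Measure ℝ) (n : ℕ) : Measure ℝ :=
  (cpois (N.restrict (largeJumps n))).map (· + (-∫ y in largeJumps n, y ∂N))

lemma isProbabilityMeasure_levyApprox (h0 : HasLevyExpMoment N 0) (n : ℕ) :
    IsProbabilityMeasure (levyApprox N n) := by
  have := isFiniteMeasure_restrict_largeJumps h0 n
  exact Measure.isProbabilityMeasure_map (by fun_prop)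

lemma lintegral_exp_levyApprox {u : ℝ} (h0 : HasLevyExpMoment N 0) (hu : HasLevyExpMoment N u)
    (n : ℕ) :
    ∫⁻ y, ENNReal.ofReal (Real.exp (u * y)) ∂(levyApprox N n) =
      ENNReal.ofReal (Real.exp (∫ y in largeJumps n, (Real.exp (u * y) - 1 - u * y) ∂N)) := by
  have := isFiniteMeasure_restrict_largeJumps h0 n
  have hi : IntegrableOn (fun y => Real.exp (u * y) - 1) (largeJumps n) N :=
    (integrableOn_largeJumps_exp hu n).sub (integrable_const _)
  rw [levyApprox, lintegral_exp_map_add_const,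
    lintegral_exp_cpois _ (integrableOn_largeJumps_exp hu n), ← ENNReal.ofReal_mul
    (Real.exp_pos _).le, ← Real.exp_add, integral_sub hi
    ((integrableOn_largeJumps_id h0 n).const_mul u), integral_const_mul]
  congr 2
  ring

lemma charFun_sub_eq_setIntegral (h0 : HasLevyExpMoment N 0) (n : ℕ) (t : ℝ) :
    charFun (N.restrict (largeJumps n)) t - (N.restrict (largeJumps n)).real Set.univ
      - Complex.I * t * (∫ y in largeJumps n, y ∂N : ℝ) =
    ∫ y : ℝ in largeJumps n, (Complex.exp (Complex.I * t * y) - 1 - Complex.I * t * y) ∂N := by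
  have := isFiniteMeasure_restrict_largeJumps h0 n
  have hi : IntegrableOn (fun y : ℝ => Complex.exp (Complex.I * t * y)) (largeJumps n) N := by
    refine (integrable_const (1 : ℝ)).mono' (by fun_prop) (ae_of_all _ fun y => ?_)
    have := Complex.norm_exp_I_mul_ofReal (t * y)
    push_cast at this
    rw [← mul_assoc] at this
    exact this.le
  have hi' : IntegrableOn (fun y : ℝ => Complex.exp (Complex.I * t * y) - 1) (largeJumps n) N :=
    hi.sub (integrable_const _)
  have hid : IntegrableOn (fun y : ℝ => Complex.I * t * (y : ℂ)) (largeJumps n) N :=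
    (integrableOn_largeJumps_id h0 n).ofReal.const_mul (Complex.I * t)
  rw [integral_sub hi' hid,
    integral_sub hi (integrable_const _), integral_const_mul, integral_complex_ofReal, charFun_apply_real,
    integral_const]
  simp [mul_comm, mul_left_comm]

lemma charFun_levyApprox (h0 : HasLevyExpMoment N 0) (n : ℕ) (t : ℝ) :
    charFun (levyApprox N n) t = Complex.exp
      (∫ y : ℝ in largeJumps n, (Complex.exp (Complex.I * t * y) - 1 - Complex.I * t * y) ∂N) := by
  have := isFiniteMeasure_restrict_largeJumps h0 n
  rw [levyApprox, charFun_map_add_const, charFun_cpois, ← charFun_sub_eq_setIntegral h0,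
    ← Complex.exp_add]
  congr 1
  simp
  ring

/-- Lévy's continuity theorem for the compound Poisson approximation. -/
lemma tendsto_levyApprox (h0 : HasLevyExpMoment N 0) {η : Measure ℝ} [hη : IsProbabilityMeasure η]
    (hch : ∀ t, charFun η t = Complex.exp (levyCharExponent N t)) :
    Tendsto (β := ProbabilityMeasure ℝ)
      (fun n => ⟨levyApprox N n, isProbabilityMeasure_levyApprox h0 n⟩) atTop (𝓝 ⟨η, hη⟩) := by
  refine ProbabilityMeasure.tendsto_of_tendsto_charFun fun t => ?_
  simp only [ProbabilityMeasure.coe_mk, charFun_levyApprox h0, hch]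
  exact (Complex.continuous_exp.tendsto _).comp
    (tendsto_setIntegral_largeJumps (integrable_cexp_sub_one_sub h0 t) (by simp))

/-- Fatou's lemma for weak convergence: f may be unbounded, at the price of an inequality. -/
lemma lintegral_le_liminf_levyApprox (h0 : HasLevyExpMoment N 0) {η : Measure ℝ}
    [hη : IsProbabilityMeasure η] (hch : ∀ t, charFun η t = Complex.exp (levyCharExponent N t))
    {f : ℝ → ℝ} (hf : Continuous f) (hf0 : ∀ y, 0 ≤ f y) :
    ∫⁻ y, ENNReal.ofReal (f y) ∂η ≤
      atTop.liminf fun n => ∫⁻ y, ENNReal.ofReal (f y) ∂(levyApprox N n) :=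
  lintegral_le_liminf_lintegral_of_forall_isOpen_measure_le_liminf_measure hf hf0 fun _ hG =>
    ProbabilityMeasure.le_liminf_measure_open_of_tendsto (tendsto_levyApprox h0 hch) hG

lemma setIntegral_largeJumps_le_levyExponent {u : ℝ} (h0 : HasLevyExpMoment N 0)
    (hu : HasLevyExpMoment N u) {s : Set ℝ} :
    ∫ y in s, (Real.exp (u * y) - 1 - u * y) ∂N ≤ levyExponent N u :=
  setIntegral_le_integral (integrable_exp_sub_one_sub h0 hu)
    (ae_of_all _ fun _ => exp_sub_one_sub_id_nonneg _)

/-- The integrand e^{uy} - 1 - uy is nonnegative, so discarding jumps only lowers the exponent; the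
bound is uniform in n and passes to the limit by Fatou. -/
lemma lintegral_exp_le {u : ℝ} (h0 : HasLevyExpMoment N 0) (hu : HasLevyExpMoment N u)
    {η : Measure ℝ} [IsProbabilityMeasure η]
    (hch : ∀ t, charFun η t = Complex.exp (levyCharExponent N t)) :
    ∫⁻ y, ENNReal.ofReal (Real.exp (u * y)) ∂η ≤ ENNReal.ofReal (Real.exp (levyExponent N u)) := by
  refine (lintegral_le_liminf_levyApprox h0 hch (f := fun y => Real.exp (u * y)) (by fun_prop)
    fun y => (Real.exp_pos _).le).trans ?_
  refine liminf_le_of_le (by isBoundedDefault) fun c hc => ?_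
  obtain ⟨n, hn⟩ := hc.exists
  refine hn.trans ?_
  rw [lintegral_exp_levyApprox h0 hu]
  exact ENNReal.ofReal_le_ofReal (Real.exp_le_exp.2 (setIntegral_largeJumps_le_levyExponent h0 hu))

lemma integrable_exp_of_charFun {u : ℝ} (h0 : HasLevyExpMoment N 0) (hu : HasLevyExpMoment N u)
    {η : Measure ℝ} [IsProbabilityMeasure η]
    (hch : ∀ t, charFun η t = Complex.exp (levyCharExponent N t)) :
    Integrable (fun y => Real.exp (u * y)) η := by
  refine (lintegral_ofReal_ne_top_iff_integrable (by fun_prop)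
    (ae_of_all _ fun y => (Real.exp_pos _).le)).1 ?_
  exact ((lintegral_exp_le h0 hu hch).trans_lt ENNReal.ofReal_lt_top).ne

lemma integral_exp_le {u : ℝ} (h0 : HasLevyExpMoment N 0) (hu : HasLevyExpMoment N u)
    {η : Measure ℝ} [IsProbabilityMeasure η]
    (hch : ∀ t, charFun η t = Complex.exp (levyCharExponent N t)) :
    ∫ y, Real.exp (u * y) ∂η ≤ Real.exp (levyExponent N u) := by
  rw [integral_eq_lintegral_of_nonneg_ae (ae_of_all _ fun y => (Real.exp_pos _).le) (by fun_prop)]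
  exact ENNReal.toReal_le_of_le_ofReal (Real.exp_pos _).le (lintegral_exp_le h0 hu hch)

lemma integrable_exp_levyApprox {u : ℝ} (h0 : HasLevyExpMoment N 0) (hu : HasLevyExpMoment N u)
    (n : ℕ) : Integrable (fun y => Real.exp (u * y)) (levyApprox N n) := by
  refine (lintegral_ofReal_ne_top_iff_integrable (by fun_prop)
    (ae_of_all _ fun y => (Real.exp_pos _).le)).1 ?_
  rw [lintegral_exp_levyApprox h0 hu]
  exact ENNReal.ofReal_ne_top

lemma integral_exp_levyApprox {u : ℝ} (h0 : HasLevyExpMoment N 0) (hu : HasLevyExpMoment N u)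
    (n : ℕ) : ∫ y, Real.exp (u * y) ∂(levyApprox N n) =
      Real.exp (∫ y in largeJumps n, (Real.exp (u * y) - 1 - u * y) ∂N) := by
  rw [integral_eq_lintegral_of_nonneg_ae (ae_of_all _ fun y => (Real.exp_pos _).le) (by fun_prop),
    lintegral_exp_levyApprox h0 hu, ENNReal.toReal_ofReal (Real.exp_pos _).le]

lemma tendsto_integral_exp_levyApprox {u : ℝ} (h0 : HasLevyExpMoment N 0)
    (hu : HasLevyExpMoment N u) :
    Tendsto (fun n => ∫ y, Real.exp (u * y) ∂(levyApprox N n)) atTop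
      (𝓝 (Real.exp (levyExponent N u))) := by
  simp only [integral_exp_levyApprox h0 hu]
  exact (Real.continuous_exp.tendsto _).comp
    (tendsto_setIntegral_largeJumps (integrable_exp_sub_one_sub h0 hu) (by simp))

/-- The moment generating function of an infinitely divisible law, at interior points. -/
lemma integral_exp_eq {u δ : ℝ} (hδ : 0 < δ) (h0 : HasLevyExpMoment N 0)
    (hu : HasLevyExpMoment N u) (hu' : HasLevyExpMoment N ((1 + δ) * u))
    {η : Measure ℝ} [IsProbabilityMeasure η]
    (hch : ∀ t, charFun η t = Complex.exp (levyCharExponent N t)) :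
    ∫ y, Real.exp (u * y) ∂η = Real.exp (levyExponent N u) := by
  refine le_antisymm (integral_exp_le h0 hu hch) ?_
  have key : ∀ k : ℝ, Real.exp (levyExponent N u) ≤ (∫ y, Real.exp (u * y) ∂η) +
      Real.exp (-δ * k) * Real.exp (levyExponent N ((1 + δ) * u)) := by
    intro k
    -- Where uy ≥ k, e^{uy} is at most e^{-δk} e^{(1+δ)uy}, so f is nonnegative. Fatou applied to f
    -- bounds the moment from below, up to an error that vanishes as k → ∞.
    set f : ℝ → ℝ := fun y =>
      Real.exp k + Real.exp (-δ * k) * Real.exp ((1 + δ) * u * y) - Real.exp (u * y) with hf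
    have hf0 : ∀ y, 0 ≤ f y := by
      intro y
      simp only [hf]
      rcases le_total (u * y) k with h | h
      · have := Real.exp_le_exp.2 h
        have : 0 ≤ Real.exp (-δ * k) * Real.exp ((1 + δ) * u * y) := by positivity
        linarith
      · have : Real.exp (u * y) ≤ Real.exp (-δ * k) * Real.exp ((1 + δ) * u * y) := by
          rw [← Real.exp_add]
          refine Real.exp_le_exp.2 ?_
          nlinarith
        linarith [Real.exp_pos k]
    have hInt : ∀ (ρ : Measure ℝ) [IsProbabilityMeasure ρ],
        Integrable (fun y => Real.exp (u * y)) ρ →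
        Integrable (fun y => Real.exp ((1 + δ) * u * y)) ρ →
        Integrable f ρ ∧ ∫ y, f y ∂ρ = Real.exp k +
          Real.exp (-δ * k) * (∫ y, Real.exp ((1 + δ) * u * y) ∂ρ) - ∫ y, Real.exp (u * y) ∂ρ := by
      intro ρ _ h1 h2
      have h3 : Integrable (fun y => Real.exp k + Real.exp (-δ * k) * Real.exp ((1 + δ) * u * y)) ρ :=
        (integrable_const _).add (h2.const_mul _)
      refine ⟨h3.sub h1, ?_⟩
      simp only [hf]
      rw [integral_sub h3 h1, integral_add (integrable_const _) (h2.const_mul _),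
        integral_const, integral_const_mul]
      simp
    have hT : Tendsto (fun n => ∫ y, f y ∂(levyApprox N n)) atTop
        (𝓝 (Real.exp k + Real.exp (-δ * k) *
          Real.exp (levyExponent N ((1 + δ) * u)) - Real.exp (levyExponent N u))) := by
      have hrw : ∀ n, ∫ y, f y ∂(levyApprox N n) = Real.exp k + Real.exp (-δ * k) *
          (∫ y, Real.exp ((1 + δ) * u * y) ∂(levyApprox N n)) -
          ∫ y, Real.exp (u * y) ∂(levyApprox N n) := fun n => by
        have := isProbabilityMeasure_levyApprox h0 n
        exact (hInt _ (integrable_exp_levyApprox h0 hu n) (integrable_exp_levyApprox h0 hu' n)).2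
      simp only [hrw]
      exact Tendsto.sub (tendsto_const_nhds.add
        (Tendsto.const_mul _ (tendsto_integral_exp_levyApprox h0 hu')))
        (tendsto_integral_exp_levyApprox h0 hu)
    have hlim := lintegral_le_liminf_levyApprox h0 hch (f := f) (by fun_prop) hf0
    have hη := hInt η (integrable_exp_of_charFun h0 hu hch) (integrable_exp_of_charFun h0 hu' hch)
    have hrw : ∀ n, ∫⁻ y, ENNReal.ofReal (f y) ∂(levyApprox N n) =
        ENNReal.ofReal (∫ y, f y ∂(levyApprox N n)) := fun n => by
      have := isProbabilityMeasure_levyApprox h0 n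
      exact (ofReal_integral_eq_lintegral_ofReal (hInt _ (integrable_exp_levyApprox h0 hu n)
        (integrable_exp_levyApprox h0 hu' n)).1 (ae_of_all _ hf0)).symm
    simp only [hrw] at hlim
    rw [(ENNReal.tendsto_ofReal hT).liminf_eq, ← ofReal_integral_eq_lintegral_ofReal hη.1
      (ae_of_all _ hf0)] at hlim
    have hle := (ENNReal.ofReal_le_ofReal_iff
      (ge_of_tendsto' hT fun n => integral_nonneg hf0)).1 hlim
    rw [hη.2] at hle
    have : 0 ≤ Real.exp (-δ * k) * ∫ y, Real.exp ((1 + δ) * u * y) ∂η :=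
      mul_nonneg (Real.exp_pos _).le (integral_nonneg fun y => (Real.exp_pos _).le)
    linarith
  have hlim : Tendsto (fun k : ℝ => (∫ y, Real.exp (u * y) ∂η) +
      Real.exp (-δ * k) * Real.exp (levyExponent N ((1 + δ) * u))) atTop
      (𝓝 ((∫ y, Real.exp (u * y) ∂η) + 0 * Real.exp (levyExponent N ((1 + δ) * u)))) := by
    refine tendsto_const_nhds.add (Tendsto.mul_const _ ?_)
    refine Real.tendsto_exp_atBot.comp ?_
    exact tendsto_id.const_mul_atTop_of_neg (by linarith)
  have := ge_of_tendsto' hlim key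
  linarith

/-- One-big-jump lower bound for the right tail of an infinitely divisible law. -/
lemma le_measure_Ici_of_charFun {s K x : ℝ} (hK : 1 ≤ x + K)
    (h0 : HasLevyExpMoment N 0) (hs : HasLevyExpMoment N (-s)) (hs0 : 0 < s)
    {η : Measure ℝ} [IsProbabilityMeasure η]
    (hch : ∀ t, charFun η t = Complex.exp (levyCharExponent N t)) :
    ENNReal.ofReal (Real.exp (-N.real (Set.Ioi 1))) * N (Set.Ioi (x + K)) *
      (1 - ENNReal.ofReal (Real.exp (-s * K + levyExponent N (-s) + s * ∫ y in Set.Ioi 1, y ∂N))) ≤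
      η (Set.Ici x) := by
  have hlim := ProbabilityMeasure.limsup_measure_closed_le_of_tendsto (tendsto_levyApprox h0 hch)
    (isClosed_Ici (a := x))
  refine le_trans ?_ hlim
  refine le_limsup_of_frequently_le (Eventually.frequently (Eventually.of_forall fun n => ?_))
  simp only [ProbabilityMeasure.coe_mk]
  have hfin := isFiniteMeasure_restrict_largeJumps h0 n
  have hfin1 : IsFiniteMeasure (N.restrict (Set.Ioi 1)) :=
    isFiniteMeasure_of_le _ (Measure.restrict_mono (Ioi_one_subset_largeJumps n) le_rfl)
  have hfin2 : IsFiniteMeasure (N.restrict (largeJumps n \ Set.Ioi 1)) :=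
    isFiniteMeasure_of_le _ (Measure.restrict_mono Set.sdiff_subset le_rfl)
  have hmd : MeasurableSet (largeJumps n \ Set.Ioi 1) :=
    (measurableSet_largeJumps n).diff measurableSet_Ioi
  set c : ℝ := -∫ y in largeJumps n, y ∂N with hc
  -- The jumps larger than 1 are split off as an independent summand; R keeps the other jumps
  -- together with the whole compensator c.
  set R : Measure ℝ := (cpois (N.restrict (largeJumps n \ Set.Ioi 1))).map (· + c) with hR
  have hRp : IsProbabilityMeasure R := Measure.isProbabilityMeasure_map (by fun_prop)
  have hsum : N.restrict (largeJumps n) =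
      N.restrict (Set.Ioi 1) + N.restrict (largeJumps n \ Set.Ioi 1) := by
    rw [← Measure.restrict_union Set.disjoint_sdiff_right hmd,
      Set.union_sdiff_cancel (Ioi_one_subset_largeJumps n)]
  have hdec : levyApprox N n = cpois (N.restrict (Set.Ioi 1)) ∗ R := by
    have := isProbabilityMeasure_levyApprox h0 n
    refine Measure.ext_of_charFun (funext fun t => ?_)
    have hInt : ∀ (ρ : Measure ℝ) [IsFiniteMeasure ρ],
        Integrable (fun y : ℝ => Complex.exp (t * y * Complex.I)) ρ := fun ρ _ =>
      (integrable_const (1 : ℝ)).mono' (by fun_prop) (ae_of_all _ fun y => by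
        have := Complex.norm_exp_ofReal_mul_I (t * y)
        push_cast at this
        exact this.le)
    have hcf : charFun (N.restrict (largeJumps n)) t = charFun (N.restrict (Set.Ioi 1)) t +
        charFun (N.restrict (largeJumps n \ Set.Ioi 1)) t := by
      rw [hsum]
      simp only [charFun_apply_real]
      exact integral_add_measure (hInt _) (hInt _)
    have hmass : (N.restrict (largeJumps n)).real Set.univ = (N.restrict (Set.Ioi 1)).real Set.univ +
        (N.restrict (largeJumps n \ Set.Ioi 1)).real Set.univ := by
      rw [hsum, measureReal_add_apply]
    rw [charFun_conv, hR, charFun_map_add_const, levyApprox, charFun_map_add_const, charFun_cpois,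
      charFun_cpois, charFun_cpois, ← mul_assoc, ← Complex.exp_add (_ - _) (_ - _), hcf, hmass,
      ← hc]
    congr 2
    push_cast
    ring
  have hid := integrableOn_largeJumps_id h0 n
  have hexp := integrableOn_largeJumps_exp hs n
  -- the remainder stays above `-K` with probability close to one
  have hRle : R (Set.Iio (-K)) ≤ ENNReal.ofReal
      (Real.exp (-s * K + levyExponent N (-s) + s * ∫ y in Set.Ioi 1, y ∂N)) := by
    have h1 : ENNReal.ofReal (Real.exp (s * K)) * R (Set.Iio (-K)) ≤
        ∫⁻ y, ENNReal.ofReal (Real.exp (-s * y)) ∂(R) := by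
      rw [← setLIntegral_const]
      refine (setLIntegral_mono' measurableSet_Iio fun y hy => ?_).trans
        (setLIntegral_le_lintegral _ _)
      refine ENNReal.ofReal_le_ofReal (Real.exp_le_exp.2 ?_)
      have hy : y < -K := hy
      nlinarith
    rw [hR, lintegral_exp_map_add_const, lintegral_exp_cpois _
      (hexp.mono_set Set.sdiff_subset), ← ENNReal.ofReal_mul (Real.exp_pos _).le,
      ← Real.exp_add] at h1
    -- R still contains the compensator of the jumps larger than 1 but not those jumps, hence the
    -- extra integral over (1, ∞). The bound no longer depends on n.
    have h2 : -s * c + ∫ y in largeJumps n \ Set.Ioi 1, (Real.exp (-s * y) - 1) ∂N ≤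
        levyExponent N (-s) + s * ∫ y in Set.Ioi 1, y ∂N := by
      have h3 := setIntegral_largeJumps_le_levyExponent h0 hs (s := largeJumps n \ Set.Ioi 1)
      have h4 : IntegrableOn (fun y => Real.exp (-s * y) - 1) (largeJumps n \ Set.Ioi 1) N :=
        (hexp.mono_set Set.sdiff_subset).sub (integrable_const _)
      have h5 : IntegrableOn (fun y => -s * y) (largeJumps n \ Set.Ioi 1) N :=
        Integrable.const_mul (hid.mono_set Set.sdiff_subset) (-s)
      rw [integral_sub h4 h5, integral_const_mul] at h3
      have h6 : ∫ y in largeJumps n, y ∂N =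
          ∫ y in Set.Ioi 1, y ∂N + ∫ y in largeJumps n \ Set.Ioi 1, y ∂N := by
        rw [hsum, integral_add_measure (hid.mono_set (Ioi_one_subset_largeJumps n))
          (hid.mono_set Set.sdiff_subset)]
      rw [hc, h6]
      linarith
    have h7 := h1.trans (ENNReal.ofReal_le_ofReal (Real.exp_le_exp.2 h2))
    calc R (Set.Iio (-K)) = ENNReal.ofReal (Real.exp (-s * K)) *
          (ENNReal.ofReal (Real.exp (s * K)) * R (Set.Iio (-K))) := by
          rw [← mul_assoc, ← ENNReal.ofReal_mul (Real.exp_pos _).le, ← Real.exp_add]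
          simp
      _ ≤ _ := by
          refine (mul_le_mul_right h7 _).trans (le_of_eq ?_)
          rw [← ENNReal.ofReal_mul (Real.exp_pos _).le, ← Real.exp_add]
          congr 2
          ring
  have hRge : 1 - ENNReal.ofReal
      (Real.exp (-s * K + levyExponent N (-s) + s * ∫ y in Set.Ioi 1, y ∂N)) ≤
      R (Set.Ici (-K)) := by
    have : R (Set.Ici (-K)) = 1 - R (Set.Iio (-K)) := by
      rw [← Set.compl_Iio, prob_compl_eq_one_sub measurableSet_Iio]
    rw [this]
    exact tsub_le_tsub_left hRle 1
  have hJ : ENNReal.ofReal (Real.exp (-N.real (Set.Ioi 1))) * N (Set.Ioi (x + K)) ≤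
      cpois (N.restrict (Set.Ioi 1)) (Set.Ioi (x + K)) := by
    have h := le_cpois_apply (N.restrict (Set.Ioi 1)) (Set.Ioi (x + K))
    rwa [measureReal_restrict_apply_univ, Measure.restrict_apply measurableSet_Ioi,
      Set.inter_eq_left.2 (Set.Ioi_subset_Ioi hK)] at h
  rw [hdec, Measure.conv, Measure.map_apply (by fun_prop) measurableSet_Ici]
  refine le_trans (mul_le_mul' hJ hRge) ?_
  rw [← Measure.prod_prod]
  refine measure_mono ?_
  rintro ⟨y, z⟩ ⟨hy, hz⟩
  simp only [Set.mem_Ioi, Set.mem_Ici, Set.mem_preimage] at *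
  linarith

end LevyMeasure

/-! ### Differentiation of the Laplace exponent. -/

noncomputable section LaplaceExponent

open scoped ENNReal Nat Topology

/-- A domination uniform in s, as needed to differentiate under the integral. -/
lemma exp_mul_le_add {u₁ u₂ s : ℝ} (h₁ : u₁ ≤ s) (h₂ : s ≤ u₂) (y : ℝ) :
    Real.exp (s * y) ≤ Real.exp (u₁ * y) + Real.exp (u₂ * y) := by
  rcases le_total 0 y with hy | hy
  · have : Real.exp (s * y) ≤ Real.exp (u₂ * y) :=
      Real.exp_le_exp.2 (mul_le_mul_of_nonneg_right h₂ hy)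
    linarith [Real.exp_pos (u₁ * y)]
  · have : Real.exp (s * y) ≤ Real.exp (u₁ * y) :=
      Real.exp_le_exp.2 (mul_le_mul_of_nonpos_right h₁ hy)
    linarith [Real.exp_pos (u₂ * y)]

variable {N : Measure ℝ}

lemma hasDerivAt_levyExponent {u₁ u₂ u : ℝ} (h0 : HasLevyExpMoment N 0)
    (hm₁ : HasLevyExpMoment N u₁) (hm₂ : HasLevyExpMoment N u₂) (h₁ : u₁ < u) (h₂ : u < u₂)
    (hu : HasLevyExpMoment N u) :
    Integrable (fun y => y * (Real.exp (u * y) - 1)) N ∧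
      HasDerivAt (levyExponent N) (∫ y, y * (Real.exp (u * y) - 1) ∂N) u := by
  refine hasDerivAt_integral_of_dominated_loc_of_deriv_le (s := Set.Ioo u₁ u₂)
    (F := fun u y => Real.exp (u * y) - 1 - u * y) (F' := fun u y => y * (Real.exp (u * y) - 1))
    (bound := fun y => (|u₁| + |u₂|) * (y ^ 2 * Real.exp (0 * y) +
      (y ^ 2 * Real.exp (u₁ * y) + y ^ 2 * Real.exp (u₂ * y))))
    (Ioo_mem_nhds h₁ h₂) (Eventually.of_forall fun _ => by fun_prop)
    (integrable_exp_sub_one_sub h0 hu) (by fun_prop) (ae_of_all _ fun y s hs => ?_)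
    ((h0.add (hm₁.add hm₂)).const_mul _) (ae_of_all _ fun y s hs => ?_)
  · have hs' : |s| ≤ |u₁| + |u₂| := by
      rw [abs_le]
      constructor
      · linarith [hs.1, neg_abs_le u₁, abs_nonneg u₂]
      · linarith [hs.2, le_abs_self u₂, abs_nonneg u₁]
    have h3 := exp_mul_le_add hs.1.le hs.2.le y
    have h4 := abs_exp_sub_one_le (s * y)
    rw [Real.norm_eq_abs, abs_mul]
    calc |y| * |Real.exp (s * y) - 1| ≤ |y| * (|s * y| * (1 + Real.exp (s * y))) :=
          mul_le_mul_of_nonneg_left h4 (abs_nonneg y)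
      _ = |s| * (y ^ 2 * (1 + Real.exp (s * y))) := by
          rw [abs_mul, ← sq_abs y]; ring
      _ ≤ (|u₁| + |u₂|) * (y ^ 2 * (1 + (Real.exp (u₁ * y) + Real.exp (u₂ * y)))) := by
          gcongr
      _ = _ := by simp only [zero_mul, Real.exp_zero]; ring
  · have h := (((hasDerivAt_id s).mul_const y).exp.sub_const 1).sub
      ((hasDerivAt_id s).mul_const y)
    refine h.congr_deriv ?_
    simp
    ring

lemma hasDerivAt_deriv_levyExponent {u₁ u₂ u : ℝ}
    (hm₁ : HasLevyExpMoment N u₁) (hm₂ : HasLevyExpMoment N u₂) (h₁ : u₁ < u) (h₂ : u < u₂)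
    (hi : Integrable (fun y => y * (Real.exp (u * y) - 1)) N) :
    HasDerivAt (fun u => ∫ y, y * (Real.exp (u * y) - 1) ∂N)
      (∫ y, y ^ 2 * Real.exp (u * y) ∂N) u := by
  refine (hasDerivAt_integral_of_dominated_loc_of_deriv_le (s := Set.Ioo u₁ u₂)
    (F := fun u y => y * (Real.exp (u * y) - 1)) (F' := fun u y => y ^ 2 * Real.exp (u * y))
    (bound := fun y => y ^ 2 * Real.exp (u₁ * y) + y ^ 2 * Real.exp (u₂ * y))
    (Ioo_mem_nhds h₁ h₂) (Eventually.of_forall fun _ => by fun_prop)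
    hi (by fun_prop) (ae_of_all _ fun y s hs => ?_)
    (hm₁.add hm₂) (ae_of_all _ fun y s hs => ?_)).2
  · rw [Real.norm_of_nonneg (by positivity), ← mul_add]
    exact mul_le_mul_of_nonneg_left (exp_mul_le_add hs.1.le hs.2.le y) (sq_nonneg y)
  · have h := (((hasDerivAt_id s).mul_const y).exp.sub_const 1).const_mul y
    refine h.congr_deriv ?_
    simp
    ring

end LaplaceExponent

/-! ### The tempered stable Lévy measure and its Laplace exponent Φ_H. -/

noncomputable section TemperedStable

open scoped ENNReal Nat Topology

/-- The Lévy measure of the standardized classical tempered stable law. -/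
def stdCTSLevyMeasure (α lp lm : ℝ) : Measure ℝ :=
  volume.withDensity fun y =>
    ENNReal.ofReal (ctsLevyDensity α lp lm (stdCTSConst α lp lm) (stdCTSConst α lp lm) y)

lemma measurable_ctsLevyDensity (α lp lm Cp Cm : ℝ) :
    Measurable (ctsLevyDensity α lp lm Cp Cm) := by
  unfold ctsLevyDensity
  refine Measurable.ite measurableSet_Ioi (by fun_prop) (Measurable.ite measurableSet_Iio
    (by fun_prop) measurable_const)

lemma ctsLevyDensity_nonneg {α lp lm Cp Cm : ℝ} (hp : 0 ≤ Cp) (hm : 0 ≤ Cm) (y : ℝ) :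
    0 ≤ ctsLevyDensity α lp lm Cp Cm y := by
  unfold ctsLevyDensity
  split_ifs <;> positivity

lemma stdCTSConst_pos {α lp lm : ℝ} (hα2 : α < 2) (hlp : 0 < lp) (hlm : 0 < lm) :
    0 < stdCTSConst α lp lm := by
  have : 0 < Real.Gamma (2 - α) := Real.Gamma_pos_of_pos (by linarith)
  unfold stdCTSConst
  positivity

variable {α lp lm : ℝ}

lemma integral_stdCTSLevyMeasure {E : Type*} [NormedAddCommGroup E] [NormedSpace ℝ E]
    (hα2 : α < 2) (hlp : 0 < lp) (hlm : 0 < lm) (f : ℝ → E) :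
    ∫ y, f y ∂(stdCTSLevyMeasure α lp lm) = ∫ y,
      ctsLevyDensity α lp lm (stdCTSConst α lp lm) (stdCTSConst α lp lm) y • f y := by
  rw [stdCTSLevyMeasure, integral_withDensity_eq_integral_toReal_smul
    (measurable_ctsLevyDensity _ _ _ _ _).ennreal_ofReal (ae_of_all _ fun _ => ENNReal.ofReal_lt_top)]
  have hC := (stdCTSConst_pos hα2 hlp hlm).le
  refine integral_congr_ae (ae_of_all _ fun y => ?_)
  simp only
  rw [ENNReal.toReal_ofReal (ctsLevyDensity_nonneg hC hC y)]

lemma integrable_stdCTSLevyMeasure_iff (hα2 : α < 2) (hlp : 0 < lp) (hlm : 0 < lm) {f : ℝ → ℝ} :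
    Integrable f (stdCTSLevyMeasure α lp lm) ↔ Integrable (fun y =>
      ctsLevyDensity α lp lm (stdCTSConst α lp lm) (stdCTSConst α lp lm) y • f y) := by
  have hC := (stdCTSConst_pos hα2 hlp hlm).le
  rw [stdCTSLevyMeasure, integrable_withDensity_iff_integrable_smul'
    (measurable_ctsLevyDensity _ _ _ _ _).ennreal_ofReal (ae_of_all _ fun _ => ENNReal.ofReal_lt_top)]
  refine integrable_congr (ae_of_all _ fun y => ?_)
  simp only
  rw [ENNReal.toReal_ofReal (ctsLevyDensity_nonneg hC hC y)]

/-- The unnormalized gamma density of shape `2 - α` and rate `c`. -/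
def tiltedJumpDensity (α c y : ℝ) : ℝ :=
  (Set.Ioi 0).indicator (fun y : ℝ => y ^ (2 - α - 1) * Real.exp (-(c * y))) y

lemma integrable_tiltedJumpDensity (hα2 : α < 2) {c : ℝ} (hc : 0 < c) :
    Integrable (tiltedJumpDensity α c) := by
  have h := integrableOn_rpow_mul_exp_neg_mul_rpow (p := 1) (s := 2 - α - 1) (b := c)
    (by linarith) one_pos hc
  simp only [Real.rpow_one, neg_mul] at h
  exact h.integrable_indicator measurableSet_Ioi

lemma integral_tiltedJumpDensity (hα2 : α < 2) {c : ℝ} (hc : 0 < c) :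
    ∫ y, tiltedJumpDensity α c y = c ^ (α - 2) * Real.Gamma (2 - α) := by
  have h : ∫ y, tiltedJumpDensity α c y =
      ∫ y in Set.Ioi 0, y ^ (2 - α - 1) * Real.exp (-(c * y)) := by
    rw [← integral_indicator measurableSet_Ioi]
    rfl
  rw [h, Real.integral_rpow_mul_exp_neg_mul_Ioi (by linarith) hc, one_div, Real.inv_rpow hc.le,
    ← Real.rpow_neg hc.le, neg_sub]

/-- The factor y² makes the singularity at 0 integrable and e^{uy} shifts the temperings to lp - u
and lm + u, leaving two gamma densities of shape 2 - α. -/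
lemma ctsLevyDensity_smul_sq_mul_exp (C u y : ℝ) :
    ctsLevyDensity α lp lm C C y • (y ^ 2 * Real.exp (u * y)) =
      C * (tiltedJumpDensity α (lp - u) y + tiltedJumpDensity α (lm + u) (-y)) := by
  have key : ∀ z c d : ℝ, 0 < z → C * Real.exp (-c * z) / z ^ (1 + α) * (z ^ 2 * Real.exp (d * z)) =
      C * (z ^ (2 - α - 1) * Real.exp (-((c - d) * z))) := by
    intro z c d hz
    have h1 : z ^ (2 - α - 1) = z ^ 2 / z ^ (1 + α) := by
      rw [← Real.rpow_natCast z 2, ← Real.rpow_sub hz]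
      congr 1
      push_cast
      ring
    have h2 : Real.exp (-((c - d) * z)) = Real.exp (-c * z) * Real.exp (d * z) := by
      rw [← Real.exp_add]
      congr 1
      ring
    rw [h1, h2]
    ring
  rw [smul_eq_mul]
  unfold ctsLevyDensity tiltedJumpDensity
  rcases lt_trichotomy y 0 with hy | rfl | hy
  · rw [if_neg (not_lt.2 hy.le), if_pos hy, Set.indicator_of_notMem (by simpa using hy.le),
      Set.indicator_of_mem (by simpa using hy), abs_of_neg hy, zero_add]
    have h := key (-y) lm (-u) (by linarith)
    rw [sub_neg_eq_add] at h
    rw [← h]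
    simp
  · simp
  · rw [if_pos hy, Set.indicator_of_mem (by simpa using hy),
      Set.indicator_of_notMem (by simpa using hy.le), add_zero]
    exact key y lp u hy

lemma hasLevyExpMoment_stdCTS (hα2 : α < 2) (hlp : 0 < lp) (hlm : 0 < lm) {u : ℝ}
    (hu : u ∈ Set.Ioo (-lm) lp) : HasLevyExpMoment (stdCTSLevyMeasure α lp lm) u := by
  unfold HasLevyExpMoment
  rw [integrable_stdCTSLevyMeasure_iff hα2 hlp hlm]
  simp only [ctsLevyDensity_smul_sq_mul_exp]
  exact ((integrable_tiltedJumpDensity hα2 (by linarith [hu.2])).add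
    (integrable_tiltedJumpDensity hα2 (by linarith [hu.1])).comp_neg).const_mul _

/-- The second derivative of the cumulant generating function of the standardized law. -/
def PhiH2 (α lp lm u : ℝ) : ℝ :=
  ((lp - u) ^ (α - 2) + (lm + u) ^ (α - 2)) / (lp ^ (α - 2) + lm ^ (α - 2))

lemma integral_sq_mul_exp_stdCTS (hα2 : α < 2) (hlp : 0 < lp) (hlm : 0 < lm) {u : ℝ}
    (hu : u ∈ Set.Ioo (-lm) lp) :
    ∫ y, y ^ 2 * Real.exp (u * y) ∂(stdCTSLevyMeasure α lp lm) = PhiH2 α lp lm u := by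
  have h1 : 0 < lp - u := by linarith [hu.2]
  have h2 : 0 < lm + u := by linarith [hu.1]
  have hG : 0 < Real.Gamma (2 - α) := Real.Gamma_pos_of_pos (by linarith)
  rw [integral_stdCTSLevyMeasure hα2 hlp hlm]
  simp only [ctsLevyDensity_smul_sq_mul_exp]
  rw [integral_const_mul, integral_add (integrable_tiltedJumpDensity hα2 h1)
    (integrable_tiltedJumpDensity hα2 h2).comp_neg,
    integral_neg_eq_self (fun y => tiltedJumpDensity α (lm + u) y),
    integral_tiltedJumpDensity hα2 h1, integral_tiltedJumpDensity hα2 h2, stdCTSConst, PhiH2]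
  have : 0 < lp ^ (α - 2) + lm ^ (α - 2) := by positivity
  field_simp

/-- The derivative of `PhiH`. -/
def PhiH1 (α lp lm u : ℝ) : ℝ :=
  if α = 1 then
    (Real.log ((lm + u) / lm) - Real.log ((lp - u) / lp)) / (lp⁻¹ + lm⁻¹)
  else
    ((lm + u) ^ (α - 1) - (lp - u) ^ (α - 1) + (lp ^ (α - 1) - lm ^ (α - 1))) /
      ((α - 1) * (lp ^ (α - 2) + lm ^ (α - 2)))

lemma hasDerivAt_PhiH (hα0 : 0 < α) (hlp : 0 < lp) (hlm : 0 < lm) {u : ℝ}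
    (hu : u ∈ Set.Ioo (-lm) lp) : HasDerivAt (PhiH α lp lm) (PhiH1 α lp lm u) u := by
  have h1 : 0 < lp - u := by linarith [hu.2]
  have h2 : 0 < lm + u := by linarith [hu.1]
  have d1 : HasDerivAt (fun u => lp - u) (-1) u := by
    simpa using (hasDerivAt_id u).const_sub lp
  have d2 : HasDerivAt (fun u => lm + u) 1 u := by
    simpa using (hasDerivAt_id u).const_add lm
  by_cases hα : α = 1
  · have hf : PhiH α lp lm = fun u => ((lp - u) * Real.log ((lp - u) / lp) +
        (lm + u) * Real.log ((lm + u) / lm)) / (lp⁻¹ + lm⁻¹) := by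
      ext u; simp [PhiH, hα]
    rw [hf, PhiH1, if_pos hα]
    have e1 := d1.mul ((d1.div_const lp).log (by positivity))
    have e2 := d2.mul ((d2.div_const lm).log (by positivity))
    refine ((e1.add e2).div_const (lp⁻¹ + lm⁻¹)).congr_deriv ?_
    congr 1
    field_simp
    ring
  · have hf : PhiH α lp lm = fun u => ((lp - u) ^ α - lp ^ α + (lm + u) ^ α - lm ^ α) /
        (α * (α - 1) * (lp ^ (α - 2) + lm ^ (α - 2))) +
        (lp ^ (α - 1) - lm ^ (α - 1)) * u / ((α - 1) * (lp ^ (α - 2) + lm ^ (α - 2))) := by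
      ext u; simp [PhiH, hα]
    rw [hf, PhiH1, if_neg hα]
    have e1 := d1.rpow_const (p := α) (Or.inl h1.ne')
    have e2 := d2.rpow_const (p := α) (Or.inl h2.ne')
    have e3 := ((hasDerivAt_id u).const_mul (lp ^ (α - 1) - lm ^ (α - 1))).div_const
      ((α - 1) * (lp ^ (α - 2) + lm ^ (α - 2)))
    refine (((((e1.sub_const (lp ^ α)).add e2).sub_const (lm ^ α)).div_const
      (α * (α - 1) * (lp ^ (α - 2) + lm ^ (α - 2)))).add e3).congr_deriv ?_
    have hD : lp ^ (α - 2) + lm ^ (α - 2) ≠ 0 := by positivity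
    have hα' : α - 1 ≠ 0 := sub_ne_zero.2 hα
    field_simp
    ring

lemma hasDerivAt_PhiH1 (hlp : 0 < lp) (hlm : 0 < lm) {u : ℝ}
    (hu : u ∈ Set.Ioo (-lm) lp) : HasDerivAt (PhiH1 α lp lm) (PhiH2 α lp lm u) u := by
  have h1 : 0 < lp - u := by linarith [hu.2]
  have h2 : 0 < lm + u := by linarith [hu.1]
  have d1 : HasDerivAt (fun u => lp - u) (-1) u := by
    simpa using (hasDerivAt_id u).const_sub lp
  have d2 : HasDerivAt (fun u => lm + u) 1 u := by
    simpa using (hasDerivAt_id u).const_add lm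
  by_cases hα : α = 1
  · have hf : PhiH1 α lp lm = fun u =>
        (Real.log ((lm + u) / lm) - Real.log ((lp - u) / lp)) / (lp⁻¹ + lm⁻¹) := by
      ext u; simp [PhiH1, hα]
    rw [hf, PhiH2]
    have e1 := (d1.div_const lp).log (by positivity)
    have e2 := (d2.div_const lm).log (by positivity)
    refine ((e2.sub e1).div_const (lp⁻¹ + lm⁻¹)).congr_deriv ?_
    rw [hα, show (1 : ℝ) - 2 = -1 by norm_num]
    simp only [Real.rpow_neg_one]
    congr 1
    field_simp
    ring
  · have hf : PhiH1 α lp lm = fun u =>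
        ((lm + u) ^ (α - 1) - (lp - u) ^ (α - 1) + (lp ^ (α - 1) - lm ^ (α - 1))) /
        ((α - 1) * (lp ^ (α - 2) + lm ^ (α - 2))) := by
      ext u; simp [PhiH1, hα]
    rw [hf, PhiH2]
    have e1 := d1.rpow_const (p := α - 1) (Or.inl h1.ne')
    have e2 := d2.rpow_const (p := α - 1) (Or.inl h2.ne')
    refine (((e2.sub e1).add_const _).div_const _).congr_deriv ?_
    have hD : lp ^ (α - 2) + lm ^ (α - 2) ≠ 0 := by positivity
    have hα' : α - 1 ≠ 0 := sub_ne_zero.2 hα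
    rw [show α - 1 - 1 = α - 2 by ring]
    field_simp
    ring

lemma PhiH_zero (hlp : 0 < lp) (hlm : 0 < lm) : PhiH α lp lm 0 = 0 := by
  unfold PhiH
  split_ifs <;> simp [hlp.ne', hlm.ne']

lemma PhiH1_zero (hlp : 0 < lp) (hlm : 0 < lm) : PhiH1 α lp lm 0 = 0 := by
  unfold PhiH1
  split_ifs <;> simp [hlp.ne', hlm.ne']

lemma PhiH_neg (u : ℝ) : PhiH α lp lm (-u) = PhiH α lm lp u := by
  unfold PhiH
  split_ifs
  · rw [sub_neg_eq_add, ← sub_eq_add_neg, add_comm lp⁻¹, add_comm (_ * _)]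
  · rw [sub_neg_eq_add, ← sub_eq_add_neg, add_comm (lp ^ (α - 2))]
    ring

lemma eqOn_of_hasDerivAt_eq {s : Set ℝ} (hs : IsOpen s) (hs' : IsPreconnected s)
    {f g f' : ℝ → ℝ} (hf : ∀ x ∈ s, HasDerivAt f (f' x) x) (hg : ∀ x ∈ s, HasDerivAt g (f' x) x)
    {x₀ : ℝ} (hx₀ : x₀ ∈ s) (h₀ : f x₀ = g x₀) : Set.EqOn f g s := by
  have hd : ∀ x ∈ s, HasDerivAt (fun x => f x - g x) 0 x := fun x hx => by
    have h := (hf x hx).sub (hg x hx)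
    rw [sub_self] at h
    exact h
  intro x hx
  have h := hs.is_const_of_deriv_eq_zero hs' (f := fun x => f x - g x)
    (fun x hx => (hd x hx).differentiableAt.differentiableWithinAt)
    (fun x hx => (hd x hx).deriv) hx hx₀
  simp only [h₀, sub_self] at h
  linarith

/-- `PhiH` is the Laplace exponent of the Lévy measure. -/
lemma levyExponent_stdCTS (hα0 : 0 < α) (hα2 : α < 2) (hlp : 0 < lp) (hlm : 0 < lm) {u : ℝ}
    (hu : u ∈ Set.Ioo (-lm) lp) :
    levyExponent (stdCTSLevyMeasure α lp lm) u = PhiH α lp lm u := by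
  have h0 : (0 : ℝ) ∈ Set.Ioo (-lm) lp := ⟨by linarith, hlp⟩
  have hmem : ∀ {w}, w ∈ Set.Ioo (-lm) lp → HasLevyExpMoment (stdCTSLevyMeasure α lp lm) w :=
    fun hw => hasLevyExpMoment_stdCTS hα2 hlp hlm hw
  have hd : ∀ w ∈ Set.Ioo (-lm) lp,
      Integrable (fun y => y * (Real.exp (w * y) - 1)) (stdCTSLevyMeasure α lp lm) ∧
      HasDerivAt (levyExponent (stdCTSLevyMeasure α lp lm))
        (∫ y, y * (Real.exp (w * y) - 1) ∂(stdCTSLevyMeasure α lp lm)) w ∧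
      HasDerivAt (fun w => ∫ y, y * (Real.exp (w * y) - 1) ∂(stdCTSLevyMeasure α lp lm))
        (PhiH2 α lp lm w) w := by
    intro w hw
    have m1 : (-lm + w) / 2 ∈ Set.Ioo (-lm) lp := ⟨by linarith [hw.1], by linarith [hw.1, hw.2]⟩
    have m2 : (w + lp) / 2 ∈ Set.Ioo (-lm) lp := ⟨by linarith [hw.1], by linarith [hw.2]⟩
    have l1 : (-lm + w) / 2 < w := by linarith [hw.1]
    have l2 : w < (w + lp) / 2 := by linarith [hw.2]
    obtain ⟨a, b⟩ := hasDerivAt_levyExponent (hmem h0) (hmem m1) (hmem m2) l1 l2 (hmem hw)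
    refine ⟨a, b, ?_⟩
    rw [← integral_sq_mul_exp_stdCTS hα2 hlp hlm hw]
    exact hasDerivAt_deriv_levyExponent (hmem m1) (hmem m2) l1 l2 a
  -- The second derivatives agree by a gamma integral that needs no separate treatment of α = 1.
  -- Integrating twice from 0, where both functions and their first derivatives vanish, avoids
  -- evaluating the compensated integral directly.
  have e1 : Set.EqOn (fun w => ∫ y, y * (Real.exp (w * y) - 1) ∂(stdCTSLevyMeasure α lp lm))
      (PhiH1 α lp lm) (Set.Ioo (-lm) lp) :=
    eqOn_of_hasDerivAt_eq isOpen_Ioo isPreconnected_Ioo (fun w hw => (hd w hw).2.2)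
      (fun w hw => hasDerivAt_PhiH1 hlp hlm hw) h0 (by simp [PhiH1_zero hlp hlm])
  refine eqOn_of_hasDerivAt_eq isOpen_Ioo isPreconnected_Ioo (f' := PhiH1 α lp lm)
    (fun w hw => ?_) (fun w hw => hasDerivAt_PhiH hα0 hlp hlm hw) h0
    (by simp [PhiH_zero hlp hlm, levyExponent]) hu
  rw [← e1 hw]
  exact (hd w hw).2.1

lemma continuous_PhiH (hα0 : 0 < α) (hlp : 0 < lp) (hlm : 0 < lm) :
    Continuous (PhiH α lp lm) := by
  by_cases hα : α = 1
  · have hf : PhiH α lp lm = fun u => (lp * ((lp - u) / lp * Real.log ((lp - u) / lp)) +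
        lm * ((lm + u) / lm * Real.log ((lm + u) / lm))) / (lp⁻¹ + lm⁻¹) := by
      ext u
      simp only [PhiH, hα, if_true]
      congr 1
      field_simp
    rw [hf]
    have h1 : Continuous fun u : ℝ => (lp - u) / lp * Real.log ((lp - u) / lp) :=
      Real.continuous_mul_log.comp (by fun_prop : Continuous fun u : ℝ => (lp - u) / lp)
    have h2 : Continuous fun u : ℝ => (lm + u) / lm * Real.log ((lm + u) / lm) :=
      Real.continuous_mul_log.comp (by fun_prop : Continuous fun u : ℝ => (lm + u) / lm)
    fun_prop
  · have hf : PhiH α lp lm = fun u => ((lp - u) ^ α - lp ^ α + (lm + u) ^ α - lm ^ α) /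
        (α * (α - 1) * (lp ^ (α - 2) + lm ^ (α - 2))) +
        (lp ^ (α - 1) - lm ^ (α - 1)) * u / ((α - 1) * (lp ^ (α - 2) + lm ^ (α - 2))) := by
      ext u; simp [PhiH, hα]
    rw [hf]
    have h1 : Continuous fun u : ℝ => (lp - u) ^ α :=
      (by fun_prop : Continuous fun u : ℝ => lp - u).rpow_const fun _ => Or.inr hα0.le
    have h2 : Continuous fun u : ℝ => (lm + u) ^ α :=
      (by fun_prop : Continuous fun u : ℝ => lm + u).rpow_const fun _ => Or.inr hα0.le
    fun_prop

lemma convexOn_PhiH (hα0 : 0 < α) (hlp : 0 < lp) (hlm : 0 < lm) :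
    ConvexOn ℝ (Set.Icc (-lm) lp) (PhiH α lp lm) := by
  refine convexOn_of_hasDerivWithinAt2_nonneg (convex_Icc _ _)
    (f' := PhiH1 α lp lm) (f'' := PhiH2 α lp lm)
    (continuous_PhiH hα0 hlp hlm).continuousOn (fun u hu => ?_) (fun u hu => ?_) fun u hu => ?_
  all_goals rw [interior_Icc] at hu
  · exact (hasDerivAt_PhiH hα0 hlp hlm hu).hasDerivWithinAt
  · exact (hasDerivAt_PhiH1 hlp hlm hu).hasDerivWithinAt
  · have h1 : 0 < lp - u := by linarith [hu.2]
    have h2 : 0 < lm + u := by linarith [hu.1]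
    unfold PhiH2
    positivity

end TemperedStable

/-! ### Conditioning on the mixing variable. -/

noncomputable section Mixture

open scoped ENNReal Nat Topology

variable {α lp lm : ℝ}

lemma stdCTSConst_scale (hlp : 0 < lp) (hlm : 0 < lm) {s : ℝ} (hs : 0 < s) :
    stdCTSConst α (lp * s) (lm * s) = s ^ (2 - α) * stdCTSConst α lp lm := by
  unfold stdCTSConst
  rw [Real.mul_rpow hlp.le hs.le, Real.mul_rpow hlm.le hs.le, ← add_mul,
    show 2 - α = -(α - 2) by ring, Real.rpow_neg hs.le, ← mul_assoc, one_div, mul_inv, one_div,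
    mul_comm]

lemma ctsLevyDensity_scale (hlp : 0 < lp) (hlm : 0 < lm) {s : ℝ} (hs : 0 < s) (x : ℝ) :
    ctsLevyDensity α (lp * s) (lm * s) (stdCTSConst α (lp * s) (lm * s))
      (stdCTSConst α (lp * s) (lm * s)) x =
    s ^ 3 * ctsLevyDensity α lp lm (stdCTSConst α lp lm) (stdCTSConst α lp lm) (s * x) := by
  have hpow : s ^ 3 = s ^ (2 - α) * s ^ (1 + α) := by
    rw [← Real.rpow_add hs, ← Real.rpow_natCast s 3]
    congr 1
    push_cast
    ring
  have key : ∀ C l z : ℝ, 0 < z → s ^ (2 - α) * C * Real.exp (-(l * s) * z) / z ^ (1 + α) =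
      s ^ 3 * (C * Real.exp (-l * (s * z)) / (s * z) ^ (1 + α)) := by
    intro C l z hz
    have : 0 < s ^ (1 + α) := by positivity
    have : 0 < z ^ (1 + α) := by positivity
    rw [hpow, Real.mul_rpow hs.le hz.le, show -l * (s * z) = -(l * s) * z by ring]
    field_simp
  rw [stdCTSConst_scale hlp hlm hs]
  unfold ctsLevyDensity
  rcases lt_trichotomy x 0 with hx | rfl | hx
  · have hsx : s * x < 0 := mul_neg_of_pos_of_neg hs hx
    rw [if_neg (not_lt.2 hx.le), if_pos hx, if_neg (not_lt.2 hsx.le), if_pos hsx, abs_mul,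
      abs_of_pos hs]
    exact key _ _ _ (abs_pos.2 hx.ne)
  · simp
  · rw [if_pos hx, if_pos (mul_pos hs hx)]
    exact key _ _ _ hx

lemma levyCharExponent_smul {v : ℝ} (hv : 0 < v) (N : Measure ℝ) (t : ℝ) :
    levyCharExponent (ENNReal.ofReal v • N) t = v * levyCharExponent N t := by
  rw [levyCharExponent, integral_smul_measure, ENNReal.toReal_ofReal hv.le, Complex.real_smul]
  rfl

lemma levyExponent_smul {v : ℝ} (hv : 0 < v) (N : Measure ℝ) (t : ℝ) :
    levyExponent (ENNReal.ofReal v • N) t = v * levyExponent N t := by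
  rw [levyExponent, integral_smul_measure, ENNReal.toReal_ofReal hv.le, smul_eq_mul]
  rfl

lemma HasLevyExpMoment.smul {N : Measure ℝ} {u : ℝ} (h : HasLevyExpMoment N u) (v : ℝ) :
    HasLevyExpMoment (ENNReal.ofReal v • N) u :=
  h.smul_measure ENNReal.ofReal_ne_top

/-- Used with s = √v, where it yields the Lévy measure v·N for √v X. Of the factor s³ in
`ctsLevyDensity_scale`, one s is absorbed by the Jacobian of y = s x. -/
lemma ctsCharExponent_scale (hα2 : α < 2) (hlp : 0 < lp) (hlm : 0 < lm) {s : ℝ} (hs : 0 < s)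
    (t : ℝ) :
    ctsCharExponent α (lp * s) (lm * s) (stdCTSConst α (lp * s) (lm * s))
      (stdCTSConst α (lp * s) (lm * s)) 0 (s * t) =
    ((s ^ 2 : ℝ) : ℂ) * levyCharExponent (stdCTSLevyMeasure α lp lm) t := by
  rw [ctsCharExponent, levyCharExponent, integral_stdCTSLevyMeasure hα2 hlp hlm]
  set C := stdCTSConst α lp lm
  have h1 : ∀ x : ℝ, (Complex.exp (Complex.I * ((s * t : ℝ) : ℂ) * x) - 1 -
      Complex.I * ((s * t : ℝ) : ℂ) * x) * (ctsLevyDensity α (lp * s) (lm * s)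
      (stdCTSConst α (lp * s) (lm * s)) (stdCTSConst α (lp * s) (lm * s)) x : ℂ) =
      ((s ^ 3 : ℝ) : ℂ) * (fun y : ℝ => ctsLevyDensity α lp lm C C y •
        (Complex.exp (Complex.I * t * y) - 1 - Complex.I * t * y)) (s * x) := by
    intro x
    rw [ctsLevyDensity_scale hlp hlm hs]
    simp only [Complex.real_smul]
    have : Complex.I * ((s * t : ℝ) : ℂ) * x = Complex.I * t * ((s * x : ℝ) : ℂ) := by
      push_cast; ring
    rw [this]
    push_cast
    ring
  simp only [h1]
  rw [integral_const_mul, Measure.integral_comp_mul_left (fun y : ℝ => ctsLevyDensity α lp lm C C y •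
        (Complex.exp (Complex.I * t * y) - 1 - Complex.I * t * y)), abs_of_pos (inv_pos.2 hs),
      Complex.real_smul, ← mul_assoc, ← Complex.ofReal_mul]
  have : s ^ 3 * s⁻¹ = s ^ 2 := by field_simp
  rw [this]
  simp

/-- `ρ` is the law of `μ + β V + L V`, where `V` has law `F` and, given `V = v`, the variable `L v`
has law `η v`, the infinitely divisible law with the tempered stable Lévy measure times `v`. -/
structure IsTSMixture (μ β α lp lm : ℝ) (F ρ : Measure ℝ) (η : ℝ → Measure ℝ) : Prop where
  ae_pos : ∀ᵐ v ∂F, 0 < v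
  ae_prob : ∀ᵐ v ∂F, IsProbabilityMeasure (η v)
  ae_charFun : ∀ᵐ v ∂F, ∀ t, charFun (η v) t =
    Complex.exp (levyCharExponent (ENNReal.ofReal v • stdCTSLevyMeasure α lp lm) t)
  lintegral_eq : ∀ f : ℝ → ℝ≥0∞, Measurable f →
    ∫⁻ y, f y ∂ρ = ∫⁻ v, ∫⁻ y, f (μ + β * v + y) ∂(η v) ∂F

lemma IsMixedTS.exists_isTSMixture {μ β : ℝ} {F ρ : Measure ℝ} [SFinite F]
    (hα2 : α < 2) (hlp : 0 < lp) (hlm : 0 < lm)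
    (h : IsMixedTS μ β α lp lm F ρ) : ∃ η, IsTSMixture μ β α lp lm F ρ η := by
  obtain ⟨hpos, κ, hκ, hcts, rfl⟩ := h
  refine ⟨fun v => (κ v).map (√v * ·), hpos, ?_, ?_, ?_⟩
  · exact ae_of_all _ fun v => Measure.isProbabilityMeasure_map (by fun_prop)
  · filter_upwards [hpos, hcts] with v hv hc t
    have hs : 0 < √v := Real.sqrt_pos.2 hv
    rw [charFun_map_mul, hc.charFun_eq, ctsCharExponent_scale hα2 hlp hlm hs, Real.sq_sqrt hv.le,
      levyCharExponent_smul hv]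
  · intro f hf
    rw [lintegral_map hf (by fun_prop), Measure.lintegral_compProd (by fun_prop)]
    refine lintegral_congr fun v => ?_
    rw [lintegral_map (by fun_prop) (by fun_prop)]

lemma ctsLevyDensity_neg (C y : ℝ) :
    ctsLevyDensity α lp lm C C (-y) = ctsLevyDensity α lm lp C C y := by
  unfold ctsLevyDensity
  rcases lt_trichotomy y 0 with hy | rfl | hy
  · rw [if_pos (by linarith), if_neg (by linarith), if_pos hy, abs_of_neg hy]
  · simp
  · rw [if_neg (by linarith), if_pos (by linarith), if_pos hy, abs_neg, abs_of_pos hy]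

lemma levyCharExponent_stdCTS_neg (hα2 : α < 2) (hlp : 0 < lp) (hlm : 0 < lm) (t : ℝ) :
    levyCharExponent (stdCTSLevyMeasure α lp lm) (-t) =
      levyCharExponent (stdCTSLevyMeasure α lm lp) t := by
  rw [levyCharExponent, levyCharExponent, integral_stdCTSLevyMeasure hα2 hlp hlm,
    integral_stdCTSLevyMeasure hα2 hlm hlp, ← integral_neg_eq_self]
  refine integral_congr_ae (ae_of_all _ fun y => ?_)
  have : stdCTSConst α lp lm = stdCTSConst α lm lp := by
    rw [stdCTSConst, stdCTSConst, add_comm]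
  simp [ctsLevyDensity_neg, this]

/-- Makes every left-tail statement an instance of the right-tail one, with lp and lm exchanged. -/
lemma IsTSMixture.neg {μ β : ℝ} {F ρ : Measure ℝ} {η : ℝ → Measure ℝ}
    (hα2 : α < 2) (hlp : 0 < lp) (hlm : 0 < lm) (h : IsTSMixture μ β α lp lm F ρ η) :
    IsTSMixture (-μ) (-β) α lm lp F (ρ.map fun y => -y) (fun v => (η v).map fun y => -y) where
  ae_pos := h.ae_pos
  ae_prob := h.ae_prob.mono fun v hv => Measure.isProbabilityMeasure_map (by fun_prop)
  ae_charFun := by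
    filter_upwards [h.ae_pos, h.ae_charFun] with v hv hc t
    have h1 := charFun_map_mul (μ := η v) (-1) t
    simp only [neg_mul, one_mul] at h1
    rw [h1, hc, levyCharExponent_smul hv, levyCharExponent_smul hv,
      levyCharExponent_stdCTS_neg hα2 hlp hlm]
  lintegral_eq f hf := by
    rw [lintegral_map hf (by fun_prop), h.lintegral_eq _ (by fun_prop)]
    refine lintegral_congr fun v => ?_
    rw [lintegral_map (by fun_prop) (by fun_prop)]
    refine lintegral_congr fun y => ?_
    congr 1
    ring

end Mixture

/-! ### Exponential moments of the mixture and the single-jump lower bound. -/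

noncomputable section Tails

open scoped ENNReal Nat Topology

variable {μ β α lp lm a b : ℝ} {ρ : Measure ℝ} {η : ℝ → Measure ℝ}

/-- Tilting by e^{cv} replaces the gamma rate b by b - c, which is still positive. -/
lemma lintegral_exp_gammaMeasure_lt_top (ha : 0 < a) {c : ℝ} (hc : c < b) :
    ∫⁻ v, ENNReal.ofReal (Real.exp (c * v)) ∂(gammaMeasure a b) < ∞ := by
  have hmeas : Measurable (gammaPDF a b) := (measurable_gammaPDFReal a b).ennreal_ofReal
  rw [gammaMeasure, lintegral_withDensity_eq_lintegral_mul _ hmeas (by fun_prop)]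
  have h := integrableOn_rpow_mul_exp_neg_mul_rpow (p := 1) (s := a - 1) (b := b - c)
    (by linarith) one_pos (by linarith)
  have h' := ((h.integrable_indicator measurableSet_Ioi).const_mul (b ^ a / Real.Gamma a)).lintegral_lt_top
  refine lt_of_le_of_lt (lintegral_mono_ae ?_) h'
  have h0 : ∀ᵐ v : ℝ, v ≠ 0 := by simp [ae_iff]
  filter_upwards [h0] with v hv
  rw [Pi.mul_apply]
  rcases lt_or_gt_of_ne hv with hv | hv
  · rw [gammaPDF_of_neg hv, zero_mul]
    exact zero_le
  · rw [gammaPDF_of_nonneg hv.le, ← ENNReal.ofReal_mul' (Real.exp_pos _).le,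
      Set.indicator_of_mem (by exact hv)]
    refine ENNReal.ofReal_le_ofReal (le_of_eq ?_)
    rw [mul_assoc, mul_assoc, ← Real.exp_add, Real.rpow_one]
    congr 3
    ring

/-- Given V = v the moment is at most e^{uμ} e^{vG(u)}, and G(u) < b makes this integrable under the
gamma law. -/
lemma IsTSMixture.integrable_exp (hα0 : 0 < α) (hα2 : α < 2) (hlp : 0 < lp) (hlm : 0 < lm)
    (ha : 0 < a) (h : IsTSMixture μ β α lp lm (gammaMeasure a b) ρ η) {u : ℝ}
    (hu : u ∈ Set.Ioo (-lm) lp) (hG : β * u + PhiH α lp lm u < b) :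
    Integrable (fun y => Real.exp (u * y)) ρ := by
  refine (lintegral_ofReal_ne_top_iff_integrable (by fun_prop)
    (ae_of_all _ fun y => (Real.exp_pos _).le)).1 ?_
  rw [h.lintegral_eq _ (by fun_prop)]
  refine ne_of_lt (lt_of_le_of_lt ?_ (ENNReal.mul_lt_top
    (ENNReal.ofReal_lt_top (r := Real.exp (u * μ))) (lintegral_exp_gammaMeasure_lt_top ha hG)))
  rw [← lintegral_const_mul _ (by fun_prop)]
  refine lintegral_mono_ae ?_
  filter_upwards [h.ae_pos, h.ae_prob, h.ae_charFun] with v hv hp hc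
  have h0 : (0 : ℝ) ∈ Set.Ioo (-lm) lp := ⟨by linarith, hlp⟩
  have hle := lintegral_exp_le ((hasLevyExpMoment_stdCTS hα2 hlp hlm h0).smul v)
    ((hasLevyExpMoment_stdCTS hα2 hlp hlm hu).smul v) hc
  rw [levyExponent_smul hv, levyExponent_stdCTS hα0 hα2 hlp hlm hu] at hle
  calc ∫⁻ y, ENNReal.ofReal (Real.exp (u * (μ + β * v + y))) ∂(η v)
      = ENNReal.ofReal (Real.exp (u * (μ + β * v))) *
          ∫⁻ y, ENNReal.ofReal (Real.exp (u * y)) ∂(η v) := by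
        rw [← lintegral_const_mul _ (by fun_prop)]
        refine lintegral_congr fun y => ?_
        rw [← ENNReal.ofReal_mul (Real.exp_pos _).le, ← Real.exp_add, ← mul_add]
    _ ≤ ENNReal.ofReal (Real.exp (u * (μ + β * v))) *
          ENNReal.ofReal (Real.exp (v * PhiH α lp lm u)) := by gcongr
    _ = _ := by
        rw [← ENNReal.ofReal_mul (Real.exp_pos _).le, ← Real.exp_add,
          ← ENNReal.ofReal_mul (Real.exp_pos _).le, ← Real.exp_add]
        congr 2
        ring

/-- A lower bound for the tail of the mixture that uses only the mixing values in a unit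
interval. -/
lemma IsTSMixture.le_measure_Ioi (ha : 0 < a) (hb : 0 < b)
    (h : IsTSMixture μ β α lp lm (gammaMeasure a b) ρ η) {w x m : ℝ} (hw : 0 < w)
    (hm : ∀ v ∈ Set.Icc w (w + 1), IsProbabilityMeasure (η v) →
      (∀ t, charFun (η v) t =
        Complex.exp (levyCharExponent (ENNReal.ofReal v • stdCTSLevyMeasure α lp lm) t)) →
      ENNReal.ofReal m ≤ gammaPDF a b v * η v (Set.Ioi (x - μ - β * v))) :
    ENNReal.ofReal m ≤ ρ (Set.Ioi x) := by
  have hmeas : Measurable (gammaPDF a b) := (measurable_gammaPDFReal a b).ennreal_ofReal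
  have h1 : ρ (Set.Ioi x) = ∫⁻ v, η v (Set.Ioi (x - μ - β * v)) ∂(gammaMeasure a b) := by
    rw [← lintegral_indicator_one measurableSet_Ioi,
      h.lintegral_eq _ (measurable_one.indicator measurableSet_Ioi)]
    refine lintegral_congr fun v => ?_
    rw [← lintegral_indicator_one measurableSet_Ioi]
    refine lintegral_congr fun y => ?_
    simp only [Set.indicator, Set.mem_Ioi]
    congr 1
    rw [eq_iff_iff]
    constructor <;> intro <;> linarith
  have hgood := h.ae_prob.and h.ae_charFun
  rw [gammaMeasure, ae_withDensity_iff hmeas] at hgood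
  -- `IsTSMixture` does not record measurability of v ↦ η v, so the version for non-measurable
  -- integrands is used; it needs only a finite density.
  rw [h1, gammaMeasure, lintegral_withDensity_eq_lintegral_mul_non_measurable _ hmeas
    (ae_of_all _ fun _ => ENNReal.ofReal_lt_top)]
  refine le_trans ?_ (setLIntegral_le_lintegral (Set.Icc w (w + 1)) _)
  calc ENNReal.ofReal m = ∫⁻ _ in Set.Icc w (w + 1), ENNReal.ofReal m := by
        rw [setLIntegral_const, Real.volume_Icc]
        simp
    _ ≤ _ := by
        refine lintegral_mono_ae ((ae_restrict_iff' measurableSet_Icc).2 ?_)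
        filter_upwards [hgood] with v hv hvI
        have hpos : 0 < gammaPDF a b v :=
          ENNReal.ofReal_pos.2 (gammaPDFReal_pos ha hb (hw.trans_le hvI.1))
        exact hm v hvI (hv hpos.ne').1 (hv hpos.ne').2

/-- For v ≥ 1 and a > 0, v^{a-1} ≥ v⁻¹: one power of v is lost, whatever the shape. -/
lemma le_gammaPDFReal (ha : 0 < a) (hb : 0 < b) {v : ℝ} (hv : 1 ≤ v) :
    b ^ a / Real.Gamma a * v⁻¹ * Real.exp (-(b * v)) ≤ gammaPDFReal a b v := by
  have hG := Real.Gamma_pos_of_pos ha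
  rw [gammaPDFReal, if_pos (by linarith)]
  gcongr
  rw [← Real.rpow_neg_one]
  exact Real.rpow_le_rpow_of_exponent_le hv (by linarith)

/-- In the variable z = x/d + k the comparison is between e^{-qdz} and e^{-pz}/z^s, so the gap p <
qd absorbs all constants, shifts and powers. -/
lemma eventually_exp_le {c d p q k s : ℝ} (hc : 0 < c) (hd : 0 < d) (hpq : p < q * d) :
    ∀ᶠ x in atTop, Real.exp (-q * x) ≤ c * (Real.exp (-p * (x / d + k)) / (x / d + k) ^ s) := by
  have hz : Tendsto (fun x : ℝ => x / d + k) atTop atTop :=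
    tendsto_atTop_add_const_right _ _ (tendsto_id.atTop_div_const hd)
  have hT := (tendsto_exp_mul_div_rpow_atTop s (q * d - p) (by linarith)).comp hz
  filter_upwards [hT.eventually_ge_atTop (Real.exp (q * d * k) / c),
    hz.eventually_gt_atTop 0] with x hx hpos
  simp only [Function.comp] at hx
  rw [div_le_iff₀ hc] at hx
  set z := x / d + k with hzdef
  have hxz : x = d * (z - k) := by rw [hzdef]; field_simp; ring
  have e1 : Real.exp (-q * x) = Real.exp (q * d * k) * Real.exp (-(q * d) * z) := by
    rw [← Real.exp_add, hxz]
    congr 1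
    ring
  have e2 : Real.exp (-p * z) = Real.exp ((q * d - p) * z) * Real.exp (-(q * d) * z) := by
    rw [← Real.exp_add]
    congr 1
    ring
  rw [e1, e2]
  calc _ ≤ Real.exp ((q * d - p) * z) / z ^ s * c * Real.exp (-(q * d) * z) := by gcongr
    _ = _ := by ring

lemma le_stdCTSLevyMeasure_Ioi (hα0 : 0 < α) (hα2 : α < 2) (hlp : 0 < lp) (hlm : 0 < lm) {z : ℝ}
    (hz : 0 ≤ z) :
    ENNReal.ofReal (stdCTSConst α lp lm * (Real.exp (-lp * (z + 1)) / (z + 1) ^ (1 + α))) ≤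
      stdCTSLevyMeasure α lp lm (Set.Ioi z) := by
  have hC := stdCTSConst_pos hα2 hlp hlm
  refine le_trans ?_ (measure_mono (Set.Ioc_subset_Ioi_self : Set.Ioc z (z + 1) ⊆ Set.Ioi z))
  rw [stdCTSLevyMeasure, withDensity_apply _ measurableSet_Ioc]
  calc _ = ∫⁻ _ in Set.Ioc z (z + 1), ENNReal.ofReal
          (stdCTSConst α lp lm * (Real.exp (-lp * (z + 1)) / (z + 1) ^ (1 + α))) := by
        rw [setLIntegral_const, Real.volume_Ioc]
        simp
    _ ≤ _ := by
        refine setLIntegral_mono' measurableSet_Ioc fun y hy => ENNReal.ofReal_le_ofReal ?_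
        have hy0 : 0 < y := hz.trans_lt hy.1
        rw [ctsLevyDensity, if_pos hy0, mul_div_assoc]
        have h1 : -lp * (z + 1) ≤ -lp * y := by nlinarith [hy.2]
        have h2 := hy.2
        gcongr

/-- The tail of the mixture is at least that of a single large jump. -/
lemma IsTSMixture.eventually_le_of_jump (hα0 : 0 < α) (hα2 : α < 2) (hlp : 0 < lp) (hlm : 0 < lm)
    (ha : 0 < a) (hb : 0 < b) (h : IsTSMixture μ β α lp lm (gammaMeasure a b) ρ η) {ε : ℝ}
    (hε : 0 < ε) :
    ∀ᶠ x in atTop, ENNReal.ofReal (Real.exp (-(lp + ε) * x)) ≤ ρ (Set.Ioi x) := by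
  set N := stdCTSLevyMeasure α lp lm with hN
  set C := stdCTSConst α lp lm with hCdef
  have hC : 0 < C := stdCTSConst_pos hα2 hlp hlm
  have h0 : HasLevyExpMoment N 0 := hasLevyExpMoment_stdCTS hα2 hlp hlm ⟨by linarith, hlp⟩
  set s := lm / 2 with hs
  have hs0 : 0 < s := by positivity
  have hms : HasLevyExpMoment N (-s) :=
    hasLevyExpMoment_stdCTS hα2 hlp hlm ⟨by linarith, by linarith⟩
  set A := levyExponent N (-s) + s * ∫ y in Set.Ioi 1, y ∂N with hA
  -- With this K, Chernoff's bound keeps the remaining part of the law above -K with probability at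
  -- least 1/2, for all v ≤ 2 at once.
  set K := (2 * |A| + Real.log 2) / s with hK
  have hG := Real.Gamma_pos_of_pos ha
  -- Dominates the drift -μ - βv for v in [1, 2]; the extra 1 makes the inequality strict, to pass
  -- from a closed to an open half-line.
  set c₀ := |μ| + 2 * |β| + 1 with hc₀
  set k := b ^ a / Real.Gamma a * 2⁻¹ * Real.exp (-(b * 2)) with hk
  have hk0 : 0 < k := by positivity
  set c := k * (Real.exp (-(2 * N.real (Set.Ioi 1))) * C * 2⁻¹) with hc
  have hc0 : 0 < c := by positivity
  filter_upwards [eventually_exp_le (c := c) (d := 1) (p := lp) (q := lp + ε) (k := c₀ + K + 1)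
    (s := 1 + α) hc0 one_pos (by linarith), eventually_ge_atTop (1 - c₀ - K)] with x hx hx1
  refine (ENNReal.ofReal_le_ofReal hx).trans
    (h.le_measure_Ioi ha hb (w := 1) one_pos fun v hv hp hch => ?_)
  rw [div_one]
  have hv0 : 0 < v := by linarith [hv.1]
  have hv2 : v ≤ 2 := by linarith [hv.2]
  have hpdf : ENNReal.ofReal k ≤ gammaPDF a b v := by
    refine ENNReal.ofReal_le_ofReal (le_trans ?_ (le_gammaPDFReal ha hb hv.1))
    rw [hk]
    gcongr
  have htail := le_measure_Ici_of_charFun (x := x + c₀) (K := K) (by linarith) (h0.smul v)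
    (hms.smul v) hs0 hch
  have hsub : Set.Ici (x + c₀) ⊆ Set.Ioi (x - μ - β * v) := by
    intro y hy
    have hy : x + c₀ ≤ y := hy
    have h1 : -μ ≤ |μ| := neg_le_abs μ
    have h2 : -β * v ≤ 2 * |β| := by nlinarith [neg_le_abs β, abs_nonneg β]
    show x - μ - β * v < y
    linarith
  have hA' : levyExponent (ENNReal.ofReal v • N) (-s) +
      s * ∫ y in Set.Ioi 1, y ∂(ENNReal.ofReal v • N) = v * A := by
    rw [levyExponent_smul hv0, Measure.restrict_smul, integral_smul_measure,
      ENNReal.toReal_ofReal hv0.le, smul_eq_mul, hA]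
    ring
  have hreal : (ENNReal.ofReal v • N).real (Set.Ioi 1) = v * N.real (Set.Ioi 1) := by
    rw [measureReal_ennreal_smul_apply, ENNReal.toReal_ofReal hv0.le]
  rw [add_assoc (-s * K), hA', hreal] at htail
  have hhalf : ENNReal.ofReal 2⁻¹ ≤ 1 - ENNReal.ofReal (Real.exp (-s * K + v * A)) := by
    have h1 : Real.exp (-s * K + v * A) ≤ 2⁻¹ := by
      have h2 : -s * K + v * A ≤ -Real.log 2 := by
        have h3 : s * K = 2 * |A| + Real.log 2 := by rw [hK]; field_simp
        have h4 : v * A ≤ 2 * |A| := by nlinarith [le_abs_self A, abs_nonneg A]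
        linarith
      calc _ ≤ Real.exp (-Real.log 2) := Real.exp_le_exp.2 h2
        _ = 2⁻¹ := by rw [Real.exp_neg, Real.exp_log two_pos]
    rw [← ENNReal.ofReal_one, ← ENNReal.ofReal_sub _ (Real.exp_pos _).le]
    exact ENNReal.ofReal_le_ofReal (by linarith)
  have hjump : ENNReal.ofReal (C * (Real.exp (-lp * (x + (c₀ + K + 1))) /
      (x + (c₀ + K + 1)) ^ (1 + α))) ≤ (ENNReal.ofReal v • N) (Set.Ioi (x + c₀ + K)) := by
    have h1 := le_stdCTSLevyMeasure_Ioi hα0 hα2 hlp hlm (z := x + c₀ + K) (by linarith)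
    rw [show x + c₀ + K + 1 = x + (c₀ + K + 1) by ring] at h1
    refine h1.trans ?_
    rw [Measure.smul_apply, smul_eq_mul]
    refine le_mul_of_one_le_left' ?_
    rw [← ENNReal.ofReal_one]
    exact ENNReal.ofReal_le_ofReal hv.1
  have hexp : ENNReal.ofReal (Real.exp (-(2 * N.real (Set.Ioi 1)))) ≤
      ENNReal.ofReal (Real.exp (-(v * N.real (Set.Ioi 1)))) := by
    refine ENNReal.ofReal_le_ofReal (Real.exp_le_exp.2 ?_)
    nlinarith [measureReal_nonneg (μ := N) (s := Set.Ioi 1)]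
  refine le_trans (le_of_eq ?_) (mul_le_mul' hpdf ((mul_le_mul' (mul_le_mul' hexp hjump)
    hhalf).trans (htail.trans (measure_mono hsub))))
  have hz : 0 < x + (c₀ + K + 1) := by linarith
  rw [← ENNReal.ofReal_mul (by positivity), ← ENNReal.ofReal_mul (by positivity),
    ← ENNReal.ofReal_mul hk0.le]
  congr 1
  rw [hc]
  ring

end Tails

/-! ### Cramér's lower bound, critical exponents and logarithmic tails. -/

noncomputable section Asymptotic

open scoped ENNReal Nat Topology

variable {μ β α lp lm a b : ℝ} {ρ : Measure ℝ} {η : ℝ → Measure ℝ}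

/-- The interval (-lm, lp) is open, so (1 + δ)u stays inside it for small δ > 0 and
`integral_exp_eq` applies. -/
lemma integral_exp_stdCTS (hα0 : 0 < α) (hα2 : α < 2) (hlp : 0 < lp) (hlm : 0 < lm) {v : ℝ}
    (hv : 0 < v) {ζ : Measure ℝ} [IsProbabilityMeasure ζ]
    (hch : ∀ t, charFun ζ t =
        Complex.exp (levyCharExponent (ENNReal.ofReal v • stdCTSLevyMeasure α lp lm) t))
    {u : ℝ} (hu : u ∈ Set.Ioo (-lm) lp) :
    Integrable (fun y => Real.exp (u * y)) ζ ∧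
      ∫ y, Real.exp (u * y) ∂ζ = Real.exp (v * PhiH α lp lm u) := by
  have h0 := (hasLevyExpMoment_stdCTS hα2 hlp hlm (u := 0) ⟨by linarith, hlp⟩).smul v
  have hu' := (hasLevyExpMoment_stdCTS hα2 hlp hlm hu).smul v
  have hcont : Continuous fun δ : ℝ => (1 + δ) * u := by fun_prop
  have hev : ∀ᶠ δ in 𝓝[>] (0 : ℝ), (1 + δ) * u ∈ Set.Ioo (-lm) lp := by
    refine nhdsWithin_le_nhds (hcont.continuousAt.eventually (Ioo_mem_nhds ?_ ?_)) <;> simp [hu.1, hu.2]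
  obtain ⟨δ, hδ, hδ0⟩ := (hev.and self_mem_nhdsWithin).exists
  refine ⟨integrable_exp_of_charFun h0 hu' hch, ?_⟩
  rw [integral_exp_eq hδ0 h0 hu' ((hasLevyExpMoment_stdCTS hα2 hlp hlm hδ).smul v) hch,
    levyExponent_smul hv, levyExponent_stdCTS hα0 hα2 hlp hlm hu]

/-- Supplies the strictly positive Chernoff rates in the tilting argument. -/
lemma exists_lt_of_hasDerivAt_lt {f : ℝ → ℝ} {f' x e δ : ℝ} (hf : HasDerivAt f f' x) (he : f' < e)
    (hδ : 0 < δ) : ∃ h, 0 < h ∧ h < δ ∧ f (x + h) - h * e < f x := by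
  have hs := hf.tendsto_slope_zero_right
  have hev := (hs.eventually_lt_const he).and (Ioo_mem_nhdsGT hδ)
  obtain ⟨h, h1, h2⟩ := hev.exists
  refine ⟨h, h2.1, h2.2, ?_⟩
  rw [smul_eq_mul, inv_mul_lt_iff₀ h2.1] at h1
  linarith

/-- Cramér's lower bound through exponential tilting. -/
lemma exists_forall_le_measureReal_Ioi (hα0 : 0 < α) (hα2 : α < 2) (hlp : 0 < lp) (hlm : 0 < lm)
    {θ e₁ e₂ : ℝ} (hθ0 : 0 < θ) (hθ : θ < lp) (he₁ : e₁ < PhiH1 α lp lm θ)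
    (he₂ : PhiH1 α lp lm θ < e₂) :
    ∃ v₀, ∀ v ≥ v₀, 0 < v → ∀ ζ : Measure ℝ, IsProbabilityMeasure ζ →
      (∀ t, charFun ζ t =
        Complex.exp (levyCharExponent (ENNReal.ofReal v • stdCTSLevyMeasure α lp lm) t)) →
      2⁻¹ * Real.exp (v * (PhiH α lp lm θ - θ * e₂)) ≤ ζ.real (Set.Ioi (e₁ * v)) := by
  have hmem : θ ∈ Set.Ioo (-lm) lp := ⟨by linarith, hθ⟩
  have hd := hasDerivAt_PhiH hα0 hlp hlm hmem
  obtain ⟨h, hh0, hhδ, hh⟩ := exists_lt_of_hasDerivAt_lt hd he₂ (sub_pos.2 hθ)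
  -- The lower deviation is the upper one for the reflected function x ↦ Φ_H(-x) at -θ.
  have hd' : HasDerivAt (fun x => PhiH α lp lm (-x)) (-PhiH1 α lp lm θ) (-θ) := by
    have h1 : HasDerivAt (PhiH α lp lm) (PhiH1 α lp lm θ) (-(-θ)) := by rwa [neg_neg]
    have h2 := h1.comp (-θ) (hasDerivAt_neg (-θ))
    rw [mul_neg_one] at h2
    exact h2
  obtain ⟨j, hj0, hjδ, hj⟩ := exists_lt_of_hasDerivAt_lt hd' (neg_lt_neg he₁) hθ0
  rw [neg_neg, neg_add_rev, neg_neg] at hj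
  -- γ and γ' are rates at which the law tilted by θ escapes from (e₁v, e₂v], upwards and downwards.
  -- For v beyond the threshold chosen below, each escape carries at most a quarter of the tilted
  -- mass.
  set γ := PhiH α lp lm θ - (PhiH α lp lm (θ + h) - h * e₂) with hγ
  set γ' := PhiH α lp lm θ - (PhiH α lp lm (-j + θ) - j * -e₁) with hγ'
  have hγ0 : 0 < γ := by linarith
  have hγ'0 : 0 < γ' := by linarith
  refine ⟨max (Real.log 4 / γ) (Real.log 4 / γ'), fun v hv hv0 ζ hζ hch => ?_⟩
  have hquarter : ∀ g : ℝ, 0 < g → Real.log 4 / g ≤ v → Real.exp (-(v * g)) ≤ 1 / 4 := by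
    intro g hg hgv
    rw [div_le_iff₀ hg] at hgv
    calc _ ≤ Real.exp (-Real.log 4) := Real.exp_le_exp.2 (by linarith)
      _ = 1 / 4 := by rw [Real.exp_neg, Real.exp_log (by norm_num), one_div]
  have q1 := hquarter γ hγ0 ((le_max_left _ _).trans hv)
  have q2 := hquarter γ' hγ'0 ((le_max_right _ _).trans hv)
  obtain ⟨i0, m0⟩ := integral_exp_stdCTS hα0 hα2 hlp hlm hv0 hch hmem
  obtain ⟨i1, m1⟩ := integral_exp_stdCTS hα0 hα2 hlp hlm hv0 hch (u := θ + h)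
    ⟨by linarith, by linarith⟩
  obtain ⟨i2, m2⟩ := integral_exp_stdCTS hα0 hα2 hlp hlm hv0 hch (u := -j + θ)
    ⟨by linarith, by linarith⟩
  -- The tilted law is never formed: e^{θy} is dominated by one term for the window and one
  -- exponential for each side, and the integrated inequality is solved for the mass of the
  -- half-line.
  have hpt : ∀ y, Real.exp (θ * y) ≤
      (Set.Ioi (e₁ * v)).indicator (fun _ => Real.exp (θ * (e₂ * v))) y +
      Real.exp (-(h * e₂ * v)) * Real.exp ((θ + h) * y) +
      Real.exp (j * e₁ * v) * Real.exp ((-j + θ) * y) := by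
    intro y
    have p1 : 0 ≤ Real.exp (-(h * e₂ * v)) * Real.exp ((θ + h) * y) := by positivity
    have p2 : 0 ≤ Real.exp (j * e₁ * v) * Real.exp ((-j + θ) * y) := by positivity
    have p0 : 0 ≤ (Set.Ioi (e₁ * v)).indicator (fun _ => Real.exp (θ * (e₂ * v))) y :=
      Set.indicator_nonneg (fun _ _ => (Real.exp_pos _).le) y
    rcases le_or_gt y (e₁ * v) with hy | hy
    · have : Real.exp (θ * y) ≤ Real.exp (j * e₁ * v) * Real.exp ((-j + θ) * y) := by
        rw [← Real.exp_add]
        exact Real.exp_le_exp.2 (by nlinarith)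
      linarith
    · rcases le_or_gt y (e₂ * v) with hy2 | hy2
      · rw [Set.indicator_of_mem (by exact hy)]
        have : Real.exp (θ * y) ≤ Real.exp (θ * (e₂ * v)) :=
          Real.exp_le_exp.2 (mul_le_mul_of_nonneg_left hy2 hθ0.le)
        linarith
      · have : Real.exp (θ * y) ≤ Real.exp (-(h * e₂ * v)) * Real.exp ((θ + h) * y) := by
          rw [← Real.exp_add]
          exact Real.exp_le_exp.2 (by nlinarith)
        linarith
  have hind : Integrable ((Set.Ioi (e₁ * v)).indicator (fun _ => Real.exp (θ * (e₂ * v)))) ζ :=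
    (integrable_const _).indicator measurableSet_Ioi
  have hInt1 : Integrable (fun y =>
      (Set.Ioi (e₁ * v)).indicator (fun _ => Real.exp (θ * (e₂ * v))) y +
      Real.exp (-(h * e₂ * v)) * Real.exp ((θ + h) * y)) ζ := hind.add (i1.const_mul _)
  have hI := integral_mono i0 (hInt1.add (i2.const_mul (Real.exp (j * e₁ * v)))) hpt
  have hI' : ∫ y, ((Set.Ioi (e₁ * v)).indicator (fun _ => Real.exp (θ * (e₂ * v))) y +
      Real.exp (-(h * e₂ * v)) * Real.exp ((θ + h) * y) +
      Real.exp (j * e₁ * v) * Real.exp ((-j + θ) * y)) ∂ζ =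
      ζ.real (Set.Ioi (e₁ * v)) * Real.exp (θ * (e₂ * v)) +
      Real.exp (v * PhiH α lp lm θ) * Real.exp (-(v * γ)) +
      Real.exp (v * PhiH α lp lm θ) * Real.exp (-(v * γ')) := by
    rw [integral_add hInt1 (i2.const_mul _), integral_add hind (i1.const_mul _),
      integral_const_mul, integral_const_mul, m1, m2, integral_indicator_const _ measurableSet_Ioi,
      smul_eq_mul]
    simp only [← Real.exp_add]
    congr 2
    · congr 1
      rw [hγ]; ring
    · rw [hγ']; ring
  rw [m0] at hI
  have hI2 := hI.trans_eq hI'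
  have hM := Real.exp_pos (v * PhiH α lp lm θ)
  have hfin : 2⁻¹ * Real.exp (v * PhiH α lp lm θ) ≤
      ζ.real (Set.Ioi (e₁ * v)) * Real.exp (θ * (e₂ * v)) := by nlinarith
  rw [show v * (PhiH α lp lm θ - θ * e₂) = v * PhiH α lp lm θ - θ * (e₂ * v) by ring, Real.exp_sub,
    ← mul_div_assoc, div_le_iff₀ (Real.exp_pos _)]
  exact hfin

/-- The tail of the mixture when the critical exponent comes from the mixing law. -/
lemma IsTSMixture.eventually_le_of_root (hα0 : 0 < α) (hα2 : α < 2) (hlp : 0 < lp) (hlm : 0 < lm)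
    (ha : 0 < a) (hb : 0 < b) (h : IsTSMixture μ β α lp lm (gammaMeasure a b) ρ η) {r : ℝ}
    (hr0 : 0 < r) (hr : r < lp) (hroot : β * r + PhiH α lp lm r = b) {ε : ℝ} (hε : 0 < ε) :
    ∀ᶠ x in atTop, ENNReal.ofReal (Real.exp (-(r + ε) * x)) ≤ ρ (Set.Ioi x) := by
  have hmem : r ∈ Set.Ioo (-lm) lp := ⟨by linarith, hr⟩
  -- the derivative at the root is positive by convexity
  have hdpos : 0 < β + PhiH1 α lp lm r := by
    have hs := (convexOn_PhiH hα0 hlp hlm).slope_le_of_hasDerivAt (x := 0) (y := r)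
      ⟨by linarith, hlp.le⟩ ⟨hmem.1.le, hmem.2.le⟩ hr0 (hasDerivAt_PhiH hα0 hlp hlm hmem)
    rw [slope_def_field, PhiH_zero hlp hlm, sub_zero, sub_zero, div_le_iff₀ hr0] at hs
    have : 0 < (β + PhiH1 α lp lm r) * r := by nlinarith
    exact pos_of_mul_pos_left this hr0.le
  set d := β + PhiH1 α lp lm r with hd
  -- Chosen so that r(1 + τ) < (r + ε)(1 - τ), that is τ(2r + ε) < ε; here the left side equals ε/2.
  set τ := ε / (2 * (2 * r + ε)) with hτ
  have hτ0 : 0 < τ := by positivity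
  have hτ1 : τ * (2 * r + ε) = ε / 2 := by rw [hτ]; field_simp
  have hτ2 : τ < 1 := by nlinarith
  set d₁ := d * (1 - τ) with hd₁
  set d₂ := d * (1 + τ) with hd₂
  have hd₁0 : 0 < d₁ := mul_pos hdpos (by linarith)
  have hd₂0 : 0 < d₂ := mul_pos hdpos (by linarith)
  obtain ⟨v₀, hv₀⟩ := exists_forall_le_measureReal_Ioi hα0 hα2 hlp hlm (e₁ := d₁ - β)
    (e₂ := d₂ - β) hr0 hr (by nlinarith) (by nlinarith)
  have hG := Real.Gamma_pos_of_pos ha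
  set c := b ^ a / Real.Gamma a * 2⁻¹ with hc
  have hc0 : 0 < c := by positivity
  have hpq : r * d₂ < (r + ε) * d₁ := by
    rw [hd₁, hd₂]
    have : 0 < d * (ε - τ * (2 * r + ε)) := mul_pos hdpos (by linarith)
    nlinarith
  have hw : Tendsto (fun x : ℝ => (x - μ) / d₁) atTop atTop :=
    (tendsto_atTop_add_const_right _ (-μ) tendsto_id).atTop_div_const hd₁0
  filter_upwards [eventually_exp_le (c := c) (d := d₁) (p := r * d₂) (q := r + ε)
    (k := 1 - μ / d₁) (s := 1) hc0 hd₁0 hpq, hw.eventually_ge_atTop 1,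
    hw.eventually_ge_atTop v₀] with x hx hx1 hx2
  -- For v ≥ w the level d₁v reaches x - μ, so the drift and the conditional deviation together
  -- exceed x.
  set w := (x - μ) / d₁ with hwdef
  have hz : x / d₁ + (1 - μ / d₁) = w + 1 := by rw [hwdef]; ring
  rw [hz, Real.rpow_one] at hx
  refine (ENNReal.ofReal_le_ofReal hx).trans
    (h.le_measure_Ioi ha hb (w := w) (by linarith) fun v hv hp hch => ?_)
  have hv1 : 1 ≤ v := hx1.trans hv.1
  have hvpos : 0 < v := by linarith
  have htail := hv₀ v (hx2.trans hv.1) hvpos (η v) hp hch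
  have hsub : Set.Ioi ((d₁ - β) * v) ⊆ Set.Ioi (x - μ - β * v) := by
    refine Set.Ioi_subset_Ioi ?_
    have : x - μ ≤ d₁ * v := by
      have := hv.1
      rw [hwdef, div_le_iff₀ hd₁0] at this
      linarith
    linarith
  have hm1 : ENNReal.ofReal (2⁻¹ * Real.exp (v * (PhiH α lp lm r - r * (d₂ - β)))) ≤
      η v (Set.Ioi (x - μ - β * v)) := by
    refine le_trans ?_ (measure_mono hsub)
    rw [← ofReal_measureReal]
    exact ENNReal.ofReal_le_ofReal htail
  have hm2 : ENNReal.ofReal (b ^ a / Real.Gamma a * v⁻¹ * Real.exp (-(b * v))) ≤ gammaPDF a b v :=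
    ENNReal.ofReal_le_ofReal (le_gammaPDFReal ha hb hv1)
  refine le_trans ?_ (mul_le_mul' hm2 hm1)
  rw [← ENNReal.ofReal_mul (by positivity)]
  refine ENNReal.ofReal_le_ofReal ?_
  -- The equation G(r) = b cancels everything but -r d₂ v in the joint cost of V and the conditional
  -- deviation.
  have he : Real.exp (-(b * v)) * Real.exp (v * (PhiH α lp lm r - r * (d₂ - β))) =
      Real.exp (-(r * d₂) * v) := by
    rw [← Real.exp_add, ← hroot]
    congr 1
    ring
  calc c * (Real.exp (-(r * d₂) * (w + 1)) / (w + 1))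
      ≤ c * (Real.exp (-(r * d₂) * v) / v) := by
        have hle : -(r * d₂) * (w + 1) ≤ -(r * d₂) * v := by
          have : 0 < r * d₂ := mul_pos hr0 hd₂0
          nlinarith [hv.2]
        have := hv.2
        gcongr
    _ = _ := by
        rw [← he, hc]
        ring

/-- The critical exponent of a convex function at a level above its value at zero. -/
lemma exists_critical {f : ℝ → ℝ} {l : ℝ} (hl : 0 < l) (hf : ConvexOn ℝ (Set.Icc 0 l) f)
    (hfc : ContinuousOn f (Set.Icc 0 l)) (hf0 : f 0 < b) :
    ∃ r, 0 < r ∧ r ≤ l ∧ (f l ≤ b → r = l) ∧ (b < f l → r < l ∧ f r = b) ∧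
      (∀ u, 0 < u → u < r → f u < b) ∧ ∀ u, 0 < u → u ≤ l → f u = b → u = r := by
  -- u is a proper convex combination of 0 and w, and the strict inequality f 0 < b makes the value
  -- at u strict.
  have key : ∀ u w, 0 < u → u < w → w ≤ l → f w ≤ b → f u < b := by
    intro u w hu huw hwl hfw
    have hw : 0 < w := hu.trans huw
    have hc := hf.2 (⟨le_rfl, hl.le⟩ : (0 : ℝ) ∈ Set.Icc 0 l) (⟨hw.le, hwl⟩ : w ∈ Set.Icc 0 l)
      (sub_nonneg.2 ((div_le_one hw).2 huw.le)) (div_nonneg hu.le hw.le)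
      (sub_add_cancel 1 (u / w))
    simp only [smul_eq_mul, mul_zero, zero_add] at hc
    rw [div_mul_cancel₀ _ hw.ne'] at hc
    have h1 : u / w < 1 := (div_lt_one hw).2 huw
    have h2 : 0 < u / w := by positivity
    nlinarith
  rcases le_or_gt (f l) b with h | h
  · refine ⟨l, hl, le_rfl, fun _ => rfl, fun h' => absurd h (not_le.2 h'),
      fun u hu hul => key u l hu hul le_rfl h, fun u hu hul hfu => ?_⟩
    by_contra hne
    exact absurd hfu (key u l hu (lt_of_le_of_ne hul hne) le_rfl h).ne
  · obtain ⟨r, hr, hfr⟩ := intermediate_value_Ioo hl.le hfc ⟨hf0, h⟩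
    refine ⟨r, hr.1, hr.2.le, fun h' => absurd h (not_lt.2 h'), fun _ => ⟨hr.2, hfr⟩,
      fun u hu hur => key u r hu hur hr.2.le hfr.le, fun u hu hul hfu => ?_⟩
    rcases lt_trichotomy u r with h1 | h1 | h1
    · exact absurd hfu (key u r hu h1 hr.2.le hfr.le).ne
    · exact h1
    · exact absurd hfr (key r u hr.1 h1 hul hfu.le).ne

lemma measureReal_Ici_le [IsProbabilityMeasure ρ] {u : ℝ} (hu : 0 ≤ u)
    (hi : Integrable (fun y => Real.exp (u * y)) ρ) (x : ℝ) :
    ρ.real (Set.Ici x) ≤ (∫ y, Real.exp (u * y) ∂ρ) * Real.exp (-u * x) := by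
  have h := measure_ge_le_exp_mul_mgf (μ := ρ) (X := id) x hu hi
  rw [mul_comm]
  exact h

/-- A finite moment of order u > r would force decay e^{-ux}, against the lower bound with ε = (u -
r)/2. -/
lemma le_of_integrable_exp [IsProbabilityMeasure ρ] {r : ℝ} (hr : 0 < r)
    (hlow : ∀ ε > 0, ∀ᶠ x in atTop, ENNReal.ofReal (Real.exp (-(r + ε) * x)) ≤ ρ (Set.Ioi x))
    {u : ℝ} (hi : Integrable (fun y => Real.exp (u * y)) ρ) : u ≤ r := by
  by_contra! hur
  set M := ∫ y, Real.exp (u * y) ∂ρ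
  have hT : Tendsto (fun x : ℝ => Real.exp ((u - r) / 2 * x)) atTop atTop :=
    Real.tendsto_exp_atTop.comp (tendsto_id.const_mul_atTop (by linarith))
  obtain ⟨x, hx1, hx2⟩ := ((hlow ((u - r) / 2) (by linarith)).and
    (hT.eventually_gt_atTop M)).exists
  have h1 : Real.exp (-(r + (u - r) / 2) * x) ≤ M * Real.exp (-u * x) := by
    refine le_trans ?_ (measureReal_Ici_le (hr.trans hur).le hi x)
    refine le_trans ?_ (measureReal_mono Set.Ioi_subset_Ici_self)
    exact (ENNReal.ofReal_le_iff_le_toReal (measure_ne_top _ _)).1 hx1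
  have h2 : Real.exp (-(r + (u - r) / 2) * x) =
      Real.exp ((u - r) / 2 * x) * Real.exp (-u * x) := by
    rw [← Real.exp_add]
    congr 1
    ring
  rw [h2] at h1
  exact absurd (le_of_mul_le_mul_right h1 (Real.exp_pos _)) (not_le.2 hx2)

/-- Letting f lie between the open and the closed tail covers both P(Y > x) and P(Y ≤ -x), the
latter being a closed tail of -Y. -/
lemma isEquivalent_log_tail [IsProbabilityMeasure ρ] {r : ℝ} (hr : 0 < r)
    (hup : ∀ u, 0 < u → u < r → Integrable (fun y => Real.exp (u * y)) ρ)
    (hlow : ∀ ε > 0, ∀ᶠ x in atTop, ENNReal.ofReal (Real.exp (-(r + ε) * x)) ≤ ρ (Set.Ioi x))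
    {f : ℝ → ℝ} (hf₁ : ∀ x, ρ.real (Set.Ioi x) ≤ f x) (hf₂ : ∀ x, f x ≤ ρ.real (Set.Ici x)) :
    (fun x => Real.log (f x)) ~[atTop] fun x => -r * x := by
  refine isLittleO_iff.2 fun c hc => ?_
  set c' := min c 1 with hc'
  have hc'0 : 0 < c' := lt_min hc one_pos
  have hc'1 : c' ≤ 1 := min_le_right _ _
  -- Half of the allowed relative error c' goes into u < r and the other half absorbs log M; c' ≤ 1
  -- keeps u positive.
  set u := r * (1 - c' / 2) with hu
  have hu0 : 0 < u := mul_pos hr (by linarith)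
  have hur : u < r := by nlinarith
  have hi := hup u hu0 hur
  set M := ∫ y, Real.exp (u * y) ∂ρ
  have hM : 0 < M := integral_exp_pos hi
  have hT : Tendsto (fun x : ℝ => r * (c' / 2) * x) atTop atTop :=
    tendsto_id.const_mul_atTop (by positivity)
  filter_upwards [hlow (r * c') (by positivity), hT.eventually_ge_atTop (Real.log M),
    eventually_gt_atTop 0] with x h1 h2 hx
  have h3 : Real.exp (-(r + r * c') * x) ≤ f x := by
    refine le_trans ?_ (hf₁ x)
    exact (ENNReal.ofReal_le_iff_le_toReal (measure_ne_top _ _)).1 h1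
  have hfpos : 0 < f x := (Real.exp_pos _).trans_le h3
  have h4 : f x ≤ M * Real.exp (-u * x) := (hf₂ x).trans (measureReal_Ici_le hu0.le hi x)
  have h5 : -(r + r * c') * x ≤ Real.log (f x) := (Real.le_log_iff_exp_le hfpos).2 h3
  have h6 : Real.log (f x) ≤ Real.log M + -u * x := by
    rw [← Real.log_exp (-u * x), ← Real.log_mul hM.ne' (Real.exp_pos _).ne']
    exact Real.log_le_log hfpos h4
  have h7 : c' * (r * x) ≤ c * (r * x) :=
    mul_le_mul_of_nonneg_right (min_le_left _ _) (by positivity)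
  have h8 : -u * x = -r * x + r * (c' / 2) * x := by rw [hu]; ring
  rw [Pi.sub_apply, Real.norm_eq_abs, Real.norm_eq_abs, neg_mul, abs_neg, abs_of_pos (mul_pos hr hx), abs_le]
  constructor <;> linarith

/-- The right critical exponent and the right tail of the mixture. -/
lemma IsTSMixture.exists_right (hα0 : 0 < α) (hα2 : α < 2) (hlp : 0 < lp) (hlm : 0 < lm)
    (ha : 0 < a) (hb : 0 < b) [IsProbabilityMeasure ρ]
    (h : IsTSMixture μ β α lp lm (gammaMeasure a b) ρ η) :
    ∃ r, 0 < r ∧ IsLUB {u : ℝ | Integrable (fun y => Real.exp (u * y)) ρ} r ∧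
      (β * lp + PhiH α lp lm lp ≤ b → r = lp) ∧
      (b < β * lp + PhiH α lp lm lp → r < lp ∧ β * r + PhiH α lp lm r = b) ∧
      (∀ u, 0 < u → u ≤ lp → β * u + PhiH α lp lm u = b → u = r) ∧
      ∀ f : ℝ → ℝ, (∀ x, ρ.real (Set.Ioi x) ≤ f x) → (∀ x, f x ≤ ρ.real (Set.Ici x)) →
        (fun x => Real.log (f x)) ~[atTop] fun x => -r * x := by
  have hcv : ConvexOn ℝ (Set.Icc 0 lp) fun u => β * u + PhiH α lp lm u := by
    refine ConvexOn.add ?_ ((convexOn_PhiH hα0 hlp hlm).subset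
      (Set.Icc_subset_Icc_left (by linarith)) (convex_Icc _ _))
    exact (LinearMap.mulLeft ℝ β).convexOn (convex_Icc _ _)
  have hct : ContinuousOn (fun u => β * u + PhiH α lp lm u) (Set.Icc 0 lp) := by
    have := continuous_PhiH hα0 hlp hlm
    fun_prop
  obtain ⟨r, hr0, hrl, hr1, hr2, hr3, hr4⟩ := exists_critical (b := b) hlp hcv hct
    (by simpa [PhiH_zero hlp hlm] using hb)
  have hup : ∀ u, 0 < u → u < r → Integrable (fun y => Real.exp (u * y)) ρ := fun u hu hur =>
    h.integrable_exp hα0 hα2 hlp hlm ha ⟨by linarith, by linarith⟩ (hr3 u hu hur)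
  have hlow : ∀ ε > 0, ∀ᶠ x in atTop,
      ENNReal.ofReal (Real.exp (-(r + ε) * x)) ≤ ρ (Set.Ioi x) := by
    intro ε hε
    rcases le_or_gt (β * lp + PhiH α lp lm lp) b with hG | hG
    · rw [hr1 hG]
      exact h.eventually_le_of_jump hα0 hα2 hlp hlm ha hb hε
    · obtain ⟨hrl', hroot⟩ := hr2 hG
      exact h.eventually_le_of_root hα0 hα2 hlp hlm ha hb hr0 hrl' hroot hε
  refine ⟨r, hr0, ⟨fun u hu => le_of_integrable_exp hr0 hlow hu, fun c hc => ?_⟩, hr1, hr2, hr4,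
    fun f hf₁ hf₂ => isEquivalent_log_tail hr0 hup hlow hf₁ hf₂⟩
  by_contra! hcr
  obtain ⟨u, hu1, hu2⟩ := exists_between (max_lt hcr hr0)
  have := hc (hup u ((le_max_right _ _).trans_lt hu1) hu2)
  exact absurd this (not_le.2 ((le_max_left _ _).trans_lt hu1))

end Asymptotic

/-! ### Assembly: the right-tail result for Y and for -Y. -/

theorem mainTheorem2 {Ω : Type*} [MeasurableSpace Ω] (P : Measure Ω) [IsProbabilityMeasure P]
    (Y : Ω → ℝ) (hY : AEMeasurable Y P)
    (μ β α lp lm a b : ℝ) (hα0 : 0 < α) (hα2 : α < 2) (hlp : 0 < lp) (hlm : 0 < lm)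
    (ha : 0 < a) (hb : 0 < b)
    (hlaw : IsMixedTS μ β α lp lm (gammaMeasure a b) (P.map Y)) :
    ∃ r q : ℝ, 0 < r ∧ 0 < q ∧
      -- `r` and `-q` are the critical exponents of the moment generating function
      IsLUB {u : ℝ | Integrable (fun ω => Real.exp (u * Y ω)) P} r ∧
      IsGLB {u : ℝ | Integrable (fun ω => Real.exp (u * Y ω)) P} (-q) ∧
      -- identification of `r` as `lp` or the root `u₊`
      (β * lp + PhiH α lp lm lp ≤ b → r = lp) ∧
      (b < β * lp + PhiH α lp lm lp → r < lp ∧ β * r + PhiH α lp lm r = b) ∧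
      -- identification of `q` as `lm`, or of `-q` as the root `u₋`
      (-β * lm + PhiH α lp lm (-lm) ≤ b → q = lm) ∧
      (b < -β * lm + PhiH α lp lm (-lm) → q < lm ∧ β * (-q) + PhiH α lp lm (-q) = b) ∧
      -- there is no other root
      (∀ u ∈ Set.Icc (-lm) lp, β * u + PhiH α lp lm u = b → u = r ∨ u = -q) ∧
      -- logarithmic tail asymptotics
      (fun x : ℝ => Real.log (P.real {ω | x < Y ω})) ~[atTop] (fun x : ℝ => -r * x) ∧
      (fun x : ℝ => Real.log (P.real {ω | Y ω ≤ -x})) ~[atTop] (fun x : ℝ => -q * x) := by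
  have := isProbabilityMeasure_gammaMeasure ha hb
  have hρ : IsProbabilityMeasure (P.map Y) := Measure.isProbabilityMeasure_map hY
  have hρ' : IsProbabilityMeasure ((P.map Y).map fun y => -y) :=
    Measure.isProbabilityMeasure_map (by fun_prop)
  obtain ⟨η, hη⟩ := hlaw.exists_isTSMixture hα2 hlp hlm
  obtain ⟨r, hr0, hrL, hr1, hr2, hr3, hr4⟩ := hη.exists_right hα0 hα2 hlp hlm ha hb
  obtain ⟨q, hq0, hqL, hq1, hq2, hq3, hq4⟩ :=
    (hη.neg hα2 hlp hlm).exists_right hα0 hα2 hlm hlp ha hb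
  have hInt : ∀ u, Integrable (fun y => Real.exp (u * y)) (P.map Y) ↔
      Integrable (fun ω => Real.exp (u * Y ω)) P := fun u =>
    integrable_map_measure (by fun_prop) hY
  have hInt' : ∀ u, Integrable (fun y => Real.exp (u * y)) ((P.map Y).map fun y => -y) ↔
      Integrable (fun ω => Real.exp (-u * Y ω)) P := fun u => by
    rw [integrable_map_measure (by fun_prop) (by fun_prop), ← hInt]
    simp [Function.comp_def]
  refine ⟨r, q, hr0, hq0, ?_, ?_, hr1, hr2, ?_, ?_, ?_, hr4 _ (fun x => ?_) (fun x => ?_),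
    hq4 _ (fun x => ?_) (fun x => ?_)⟩
  · simpa only [hInt] using hrL
  · simp only [hInt'] at hqL
    constructor
    · intro u hu
      have hmem : -u ∈ {u : ℝ | Integrable (fun ω => Real.exp (-u * Y ω)) P} := by
        show Integrable (fun ω => Real.exp (- -u * Y ω)) P
        rw [neg_neg]
        exact hu
      have h := hqL.1 hmem
      linarith
    · intro c hc
      have hub : -c ∈ upperBounds {u : ℝ | Integrable (fun ω => Real.exp (-u * Y ω)) P} := by
        intro u hu
        have hmem : -u ∈ {u : ℝ | Integrable (fun ω => Real.exp (u * Y ω)) P} := hu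
        linarith [hc hmem]
      linarith [hqL.2 hub]
  · rwa [PhiH_neg]
  · rw [PhiH_neg, PhiH_neg, mul_neg, ← neg_mul]
    exact hq2
  · intro u hu hroot
    -- Zero is not a root because G(0) = 0 < b; roots of either sign are covered by one-sided
    -- uniqueness.
    rcases lt_trichotomy u 0 with h | rfl | h
    · right
      have h1 := hq3 (-u) (by linarith) (by linarith [hu.1]) (by
        rw [← PhiH_neg, neg_neg]
        linarith)
      linarith
    · rw [PhiH_zero hlp hlm] at hroot
      linarith
    · exact Or.inl (hr3 u h hu.2 hroot)
  · rw [map_measureReal_apply_of_aemeasurable hY measurableSet_Ioi]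
    rfl
  · rw [map_measureReal_apply_of_aemeasurable hY measurableSet_Ici]
    exact measureReal_mono fun ω (hω : x < Y ω) => hω.le
  · rw [map_measureReal_apply (by fun_prop) measurableSet_Ioi,
      map_measureReal_apply_of_aemeasurable hY (measurable_neg measurableSet_Ioi)]
    refine measureReal_mono fun ω hω => ?_
    have hω : x < -Y ω := hω
    show Y ω ≤ -x
    linarith
  · rw [map_measureReal_apply (by fun_prop) measurableSet_Ici,
      map_measureReal_apply_of_aemeasurable hY (measurable_neg measurableSet_Ici)]
    refine measureReal_mono fun ω hω => ?_
    have hω : Y ω ≤ -x := hω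
    show x ≤ -Y ω
    linarith
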